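/- Let $M\ge 3$. Two narrow-band sources with spatial frequencies $\mu_1,\mu_2$, $0<\Delta\mu:=|\mu_2-\mu_1|<2\pi$, impinge on an $M$-element uniform linear array with sensor positions $k_m=m-\frac{M-1}{2}+\delta$, $m=0,\dots,M-1$ (so $\delta\in\mathbb R$ is the phase reference relative to the array centroid). The observations are $X=A\Psi S_0+W\in\mathbb C^{M\times N}$ with $A=[e^{\mathrm j k_m\mu_i}]_{m,i}$, $\Psi=\mathrm{diag}(e^{\mathrm j\varphi_1},e^{\mathrm j\varphi_2})$, real symbols $S_0\in\mathbb R^{2\times N}$ with nonzero rows $s_1,s_2$, and white circularly symmetric complex Gaussian noise $W$ of variance $\sigma^2>0$. Let $$\hat\rho=\frac{s_1^{T}s_2}{\|s_1\|\,\|s_2\|},\qquad \Delta\phi=(\varphi_2-\varphi_1)+\delta(\mu_2-\mu_1).$$ Let $C$ be the deterministic Cramér–Rao bound matrix for $(\mu_1,\mu_2)$ for arbitrary complex symbols, i.e. the $\mu$-block of the inverse Fisher information matrix of the parameters $(\mu,\mathrm{Re}\,S,\mathrm{Im}\,S,\sigma^2)$ at $S=\Psi S_0$, and let $C_{nc}$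 be the bound for strictly non-circular sources, i.e. the $\mu$-block of the inverse Fisher information matrix of the parameters $(\mu,S_0,\varphi,\sigma^2)$. If $M=3$, assume also $\hat\rho^2\cos^2\Delta\phi<1$ (otherwise the Fisher matrices are singular). Then $\mathrm{Tr}\,C>0$ and $\mathrm{Tr}\,C_{nc}>0$ are well defined. Let $\eta_{nc}=\mathrm{Tr}(C)/\mathrm{Tr}(C_{nc})$ be the NC gain and $$E=1+\frac{140(1-\hat\rho^2)M(M-1)(M+1)\sin^2(\Delta\phi)\,\bigl(60-\Delta\mu^2(M-2)(M+2)\bigr)}{\Delta\mu^2M(M-1)(M-2)(M+2)(M+1)\bigl(\Delta\mu^2\hat\rho^2(M-3)(M+3)\cos^2(\Delta\phi)+140(1-\hat\rho^2\cos^2(\Delta\phi))\bigr)}.$$ 1. (Approximation) For closely spaced sources $\eta_{nc}\approx E$, in the following sense: there are $K$ and $u_0>0$ depending only on $M$ such that, whenever $\Delta\mu<u_0$, one has $E>0$ and $|\eta_{nc}-E|\le K\,\Delta\mu^2\,E$, for all $N,S_0,\sigma^2,\delta,\mu_i,\varphi_i$. 2. (No gain) If $|\hat\rho|=1$, or if $\sin\Delta\phi=0$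 (in particular if $\Delta\phi=0$), then $\eta_{nc}=1$ and $E=1$. 3. (Maximal gain) If $\hat\rho=0$ and $\cos\Delta\phi=0$ (in particular, for uncorrelated sources with $|\varphi_2-\varphi_1|=\pi/2$ and phase reference at the centroid, $\delta=0$), then $$E=E_{\max}:=\frac{1}{\Delta\mu^2}\cdot\frac{60}{(M-2)(M+2)},$$ and $|\eta_{nc}-E_{\max}|\le K\,\Delta\mu^2\,E_{\max}$ whenever $\Delta\mu<u_0$. This is the maximal case: for given $M$ and $\Delta\mu$, the gain $\eta_{nc}$ of any two sources is at most the gain of any two sources with $\hat\rho=0$ and $\cos\Delta\phi=0$, and always $E\le E_{\max}$ as long as $\Delta\mu^2(M-2)(M+2)\le 60$. -/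

import Mathlib

open scoped Matrix

noncomputable section

namespace NCGain

/-! Fisher information and Cramér-Rao bound of a circularly symmetric complex Gaussian model. -/

/-- The partial derivative of `f` with respect to the real parameter `p` at `ξ`. -/
def pderiv {ι : Type*} [DecidableEq ι] (p : ι) (f : (ι → ℝ) → ℂ) (ξ : ι → ℝ) : ℂ :=
  deriv (fun t : ℝ => f (Function.update ξ p t)) (ξ p)

/-- Fisher information matrix (Slepian-Bangs form) of `x ~ CN(ν(ξ), V(ξ))` for a real parameter
vector `ξ`:
`J p q = Tr (V⁻¹ (∂V/∂ξ_p) V⁻¹ (∂V/∂ξ_q)) + 2 Re ((∂ν/∂ξ_p)ᴴ V⁻¹ (∂ν/∂ξ_q))`. -/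
def fisherInfo {ι κ : Type*} [DecidableEq ι] [Fintype κ] [DecidableEq κ]
    (ν : (ι → ℝ) → κ → ℂ) (V : (ι → ℝ) → Matrix κ κ ℂ) (ξ : ι → ℝ) : Matrix ι ι ℝ :=
  Matrix.of fun p q =>
    (((V ξ)⁻¹ * Matrix.of (fun a b => pderiv p (fun ζ => V ζ a b) ξ) *
        (V ξ)⁻¹ * Matrix.of (fun a b => pderiv q (fun ζ => V ζ a b) ξ)).trace).re +
      2 * (star (fun a => pderiv p (fun ζ => ν ζ a) ξ) ⬝ᵥ
        ((V ξ)⁻¹ *ᵥ fun a => pderiv q (fun ζ => ν ζ a) ξ)).re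

/-! The uniform linear array. -/

/-- Position of sensor `m` of the `M`-element uniform linear array; the positions have mean `δ`,
so that `δ = 0` means that the phase reference is at the array centroid. -/
def sensorPos (M : ℕ) (δ : ℝ) (m : Fin M) : ℝ := (m : ℝ) - ((M : ℝ) - 1) / 2 + δ

/-- The array steering matrix `A`, with entries `exp (j k_m μ_i)`. -/
def steeringMatrix (M : ℕ) (δ : ℝ) {d : ℕ} (μ : Fin d → ℝ) : Matrix (Fin M) (Fin d) ℂ :=
  Matrix.of fun m i => Complex.exp (Complex.I * ((sensorPos M δ m * μ i : ℝ) : ℂ))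

/-- The matrix `Ψ` of rotation phases. -/
def phaseMatrix {d : ℕ} (φ : Fin d → ℝ) : Matrix (Fin d) (Fin d) ℂ :=
  Matrix.diagonal fun i => Complex.exp (Complex.I * (φ i : ℂ))

/-- The symbol matrix `S = Ψ S₀` of strictly non-circular sources. -/
def symbols {d N : ℕ} (φ : Fin d → ℝ) (S₀ : Matrix (Fin d) (Fin N) ℝ) :
    Matrix (Fin d) (Fin N) ℂ :=
  phaseMatrix φ * S₀.map (fun x : ℝ => (x : ℂ))

/-- The covariance `σ² I` of the (vectorised) noise. -/
def noiseCov (M N : ℕ) (σ2 : ℝ) : Matrix (Fin M × Fin N) (Fin M × Fin N) ℂ :=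
  (σ2 : ℂ) • (1 : Matrix (Fin M × Fin N) (Fin M × Fin N) ℂ)

/-! Arbitrary signals: the parameters are `μ`, `Re S`, `Im S`, `σ²`. -/

abbrev ArbParam (d N : ℕ) : Type :=
  Fin d ⊕ ((Fin d × Fin N) ⊕ ((Fin d × Fin N) ⊕ Unit))

/-- The parameter vector `(μ, Re S, Im S, σ²)`. -/
def arbPoint {d N : ℕ} (μ : Fin d → ℝ) (S : Matrix (Fin d) (Fin N) ℂ) (σ2 : ℝ) :
    ArbParam d N → ℝ :=
  Sum.elim μ (Sum.elim (fun p => (S p.1 p.2).re)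
    (Sum.elim (fun p => (S p.1 p.2).im) (fun _ => σ2)))

/-- Mean `A(μ) S` of the observations. -/
def arbMean (M : ℕ) (δ : ℝ) {d N : ℕ} (ξ : ArbParam d N → ℝ) (a : Fin M × Fin N) : ℂ :=
  (steeringMatrix M δ (fun i => ξ (Sum.inl i)) *
    Matrix.of (fun (i : Fin d) (t : Fin N) =>
      (ξ (Sum.inr (Sum.inl (i, t))) : ℂ) +
        Complex.I * (ξ (Sum.inr (Sum.inr (Sum.inl (i, t)))) : ℂ))) a.1 a.2

def arbCov (M : ℕ) {d N : ℕ} (ξ : ArbParam d N → ℝ) :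
    Matrix (Fin M × Fin N) (Fin M × Fin N) ℂ :=
  noiseCov M N (ξ (Sum.inr (Sum.inr (Sum.inr ()))))

/-- The deterministic CRB matrix `C` for arbitrary signals: the `μ`-block of the inverse of the
Fisher information matrix. -/
def crb (M : ℕ) (δ : ℝ) {d N : ℕ} (μ : Fin d → ℝ) (S : Matrix (Fin d) (Fin N) ℂ) (σ2 : ℝ) :
    Matrix (Fin d) (Fin d) ℝ :=
  ((fisherInfo (arbMean M δ) (arbCov M) (arbPoint μ S σ2))⁻¹).toBlocks₁₁

/-! Strictly non-circular signals: the parameters are `μ`, `S₀`, `φ`, `σ²`. -/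

abbrev NCParam (d N : ℕ) : Type :=
  Fin d ⊕ ((Fin d × Fin N) ⊕ (Fin d ⊕ Unit))

/-- The parameter vector `(μ, S₀, φ, σ²)`. -/
def ncPoint {d N : ℕ} (μ : Fin d → ℝ) (S₀ : Matrix (Fin d) (Fin N) ℝ) (φ : Fin d → ℝ)
    (σ2 : ℝ) : NCParam d N → ℝ :=
  Sum.elim μ (Sum.elim (fun p => S₀ p.1 p.2) (Sum.elim φ (fun _ => σ2)))

/-- Mean `A(μ) Ψ S₀` of the observations. -/
def ncMean (M : ℕ) (δ : ℝ) {d N : ℕ} (ξ : NCParam d N → ℝ) (a : Fin M × Fin N) : ℂ :=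
  (steeringMatrix M δ (fun i => ξ (Sum.inl i)) *
    symbols (fun i => ξ (Sum.inr (Sum.inr (Sum.inl i))))
      (Matrix.of fun (i : Fin d) (t : Fin N) => ξ (Sum.inr (Sum.inl (i, t))))) a.1 a.2

def ncCov (M : ℕ) {d N : ℕ} (ξ : NCParam d N → ℝ) :
    Matrix (Fin M × Fin N) (Fin M × Fin N) ℂ :=
  noiseCov M N (ξ (Sum.inr (Sum.inr (Sum.inr ()))))

/-- The deterministic NC CRB matrix `C_nc` for strictly non-circular signals: the `μ`-block of the
inverse of the Fisher information matrix. -/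
def ncCrb (M : ℕ) (δ : ℝ) {d N : ℕ} (μ : Fin d → ℝ) (S₀ : Matrix (Fin d) (Fin N) ℝ)
    (φ : Fin d → ℝ) (σ2 : ℝ) : Matrix (Fin d) (Fin d) ℝ :=
  ((fisherInfo (ncMean M δ) (ncCov M) (ncPoint μ S₀ φ σ2))⁻¹).toBlocks₁₁

/-! Empirical second-order quantities. -/

/-- The empirical power `‖s_i‖² / N` of source `i`. -/
def empPower {d N : ℕ} (S₀ : Matrix (Fin d) (Fin N) ℝ) (i : Fin d) : ℝ :=
  (∑ t, S₀ i t ^ 2) / N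

/-- The empirical correlation coefficient of sources `i` and `j`. -/
def empCorr {d N : ℕ} (S₀ : Matrix (Fin d) (Fin N) ℝ) (i j : Fin d) : ℝ :=
  (1 / (N : ℝ)) * ((∑ t, S₀ i t * S₀ j t) / Real.sqrt (empPower S₀ i * empPower S₀ j))

/-- Two strictly non-circular sources of nonzero power, with distinct spatial frequencies, that
impinge on an `M`-element uniform linear array in noise of positive power. -/
structure TwoSources (M : ℕ) where
  /-- number of snapshots -/
  N : ℕ
  /-- real-valued symbols -/
  S₀ : Matrix (Fin 2) (Fin N) ℝ
  /-- noise power -/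
  σ2 : ℝ
  /-- phase reference relative to the array centroid -/
  δ : ℝ
  /-- spatial frequencies -/
  μ : Fin 2 → ℝ
  /-- rotation phases -/
  φ : Fin 2 → ℝ
  symbols_ne : ∀ i, S₀ i ≠ 0
  noise_pos : 0 < σ2
  freq_ne : μ 0 ≠ μ 1
  freq_lt : |μ 1 - μ 0| < 2 * Real.pi

namespace TwoSources

variable {M : ℕ}

/-- Source separation `Δμ`. -/
def sep (c : TwoSources M) : ℝ := |c.μ 1 - c.μ 0|

/-- Phase separation `Δφ` at the array centroid: the rotation phase difference, corrected by the
shift of the phase reference. -/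
def phaseSep (c : TwoSources M) : ℝ := (c.φ 1 - c.φ 0) + c.δ * (c.μ 1 - c.μ 0)

/-- Empirical correlation `ρ̂` of the two sources. -/
def corr (c : TwoSources M) : ℝ := empCorr c.S₀ 0 1

/-- `Tr C`. -/
def trCrb (c : TwoSources M) : ℝ := (crb M c.δ c.μ (symbols c.φ c.S₀) c.σ2).trace

/-- `Tr C_nc`. -/
def trNcCrb (c : TwoSources M) : ℝ := (ncCrb M c.δ c.μ c.S₀ c.φ c.σ2).trace

/-- The asymptotic NC gain `Tr C / Tr C_nc`. -/
def gain (c : TwoSources M) : ℝ := c.trCrb / c.trNcCrb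

/-- Only coherent sources with equal phases (modulo `π`) on a three-element array are excluded:
there the Fisher information matrices are singular. -/
def Resolvable (c : TwoSources M) : Prop :=
  4 ≤ M ∨ c.corr ^ 2 * Real.cos c.phaseSep ^ 2 < 1

end TwoSources

/-- The analytical NC gain expression in `M`, `Δμ = u`, `ρ̂ = ρ`, `Δφ = ψ`. -/
def gainExpr (M : ℕ) (u ρ ψ : ℝ) : ℝ :=
  1 + (140 * (1 - ρ ^ 2) * M * (M - 1) * (M + 1) * Real.sin ψ ^ 2 *
        (60 - u ^ 2 * (M - 2) * (M + 2))) /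
      (u ^ 2 * M * (M - 1) * (M - 2) * (M + 2) * (M + 1) *
        (u ^ 2 * ρ ^ 2 * (M - 3) * (M + 3) * Real.cos ψ ^ 2 +
          140 * (1 - ρ ^ 2 * Real.cos ψ ^ 2)))

/-- The largest value of the gain expression. -/
def maxGainExpr (M : ℕ) (u : ℝ) : ℝ := 1 / u ^ 2 * (60 / ((M - 2) * (M + 2)))

end NCGain

end

noncomputable section

namespace NCGain

/-! ### Schur complements of Gram matrices -/

/-! With noise covariance σ²I the Fisher matrix is a Gram matrix, namely that of the derivatives of
(mean, noise power) for the form `infoForm`. The μ-block of its inverse is the inverse Gram matrix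
of what remains of the frequency tangents after projecting out the nuisance tangents. Both bounds
thus reduce to projections of steering vector derivatives (`exists_residual`, `exists_residual_nc`).

Write p = Σk², c = Σcos(kΔμ), t = ρ̂ cos Δφ, h = (1-ρ̂²) sin²Δφ. For arbitrary symbols all complex
multiples of the steering vectors are projected out, which leaves diagonal entries α = `projPow` and
off-diagonal entries tβ, β = `projCross`. For real symbols only real multiples and the two rotation
phases are projected out, so more information survives. Up to a common scaling by the symbol norms
both 2×2 matrices have equal diagonal entries x and off-diagonal entries y, so the gain is a
quotient of two values x/(x²-y²). With ε = 1-(β/α)², `gain_formula` gives gain = 1 +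
h·((p-α)/α)/(1-t²+t²ε)·(1+r). E has the same shape, with α, ε, r replaced by `projPowCoeff M`·Δμ²,
(M²-9)/140·Δμ² and 0. If h = 0, both equal 1.

For the approximation each of the three factors needs a relative error O(Δμ²), uniformly in the
sources. The definition of α hides a cancellation for small Δμ. Lagrange's identity therefore
rewrites α+β and α-β as sums of squared 2×2 minors; these show positivity on (0, 2π) and the orders
Δμ⁴ and Δμ². The source parameters enter only through t² ≤ 1 and h ≥ 0, which can only shrink the
error of the denominator and the correction r.

For maximality, `gain_le` bounds the gain by p/α, the value at t = 0, h = 1: since h ≤ (1-|t|)², the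
eigenvalues of the non-circular information matrix are bounded by those of a simpler one. -/

/-- Here `r i` is the part of the frequency tangent orthogonal to the nuisance tangents, so `H` is
the Schur complement. No block inversion is needed: the coordinate matrix of `r` is already `J⁻¹`
times a matrix whose nuisance rows vanish. -/
theorem inv_toBlocks₁₁_of_gram {m n E : Type*} [Fintype m] [DecidableEq m] [Fintype n]
    [DecidableEq n] [AddCommGroup E] [Module ℝ E] (B : LinearMap.BilinForm ℝ E)
    (hdef : ∀ x, B x x = 0 → x = 0) (t : m ⊕ n → E)
    (J : Matrix (m ⊕ n) (m ⊕ n) ℝ) (hJ : ∀ p q, J p q = B (t p) (t q))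
    (hli : LinearIndependent ℝ (fun j => t (Sum.inr j))) (r : m → E)
    (hspan : ∀ i, t (Sum.inl i) - r i ∈ Submodule.span ℝ (Set.range fun j => t (Sum.inr j)))
    (horth : ∀ i j, B (t (Sum.inr j)) (r i) = 0) (H : Matrix m m ℝ)
    (hH : ∀ i j, H i j = B (t (Sum.inl i)) (r j)) (hdet : IsUnit H.det) :
    J⁻¹.toBlocks₁₁ = H⁻¹ := by
  choose Z hZ using fun i => (Submodule.mem_span_range_iff_exists_fun ℝ).1 (hspan i)
  have hJdet : IsUnit J.det := by
    rw [isUnit_iff_ne_zero]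
    intro h0
    obtain ⟨v, hv0, hv⟩ := Matrix.exists_mulVec_eq_zero_iff.2 h0
    apply hv0
    have he : ∑ p, v p • t p = 0 := by
      apply hdef
      have h1 : ∀ p, B (t p) (∑ q, v q • t q) = 0 := by
        intro p
        have := congrFun hv p
        simp only [Matrix.mulVec, dotProduct, hJ, Pi.zero_apply] at this
        rw [map_sum, ← this]
        exact Finset.sum_congr rfl fun q _ => by rw [map_smul, smul_eq_mul, mul_comm]
      rw [LinearMap.map_sum₂]
      exact Finset.sum_eq_zero fun p _ => by rw [map_smul, LinearMap.smul_apply, h1, smul_zero]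
    -- Pairing the relation Σ v_p t_p = 0 with `r j` kills the nuisance tangents and leaves vH = 0.
    -- Independence of the nuisance tangents then disposes of the remaining coordinates.
    have hm : (fun i => v (Sum.inl i)) = 0 := by
      have h2 : (fun i => v (Sum.inl i)) ᵥ* H = 0 := by
        ext j
        have h3 : B (∑ p, v p • t p) (r j) = 0 := by rw [he]; simp
        rw [Fintype.sum_sum_type, map_add, LinearMap.add_apply, map_sum, map_sum,
          LinearMap.sum_apply, LinearMap.sum_apply] at h3
        simpa [Matrix.vecMul, dotProduct, hH, horth] using h3
      by_contra hne
      exact hdet.ne_zero (Matrix.exists_vecMul_eq_zero_iff.1 ⟨_, hne, h2⟩)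
    have hm' : ∀ i, v (Sum.inl i) = 0 := fun i => congrFun hm i
    rw [Fintype.sum_sum_type] at he
    simp only [hm', zero_smul, Finset.sum_const_zero, zero_add] at he
    have hn := Fintype.linearIndependent_iff.1 hli _ he
    ext p
    cases p with
    | inl i => exact hm' i
    | inr j => exact hn j
  -- The columns of `W` are the coordinates of the `r j` in the family `t`. Hence `J * W` has upper
  -- block `H` and lower block 0, and the upper rows of `W = J⁻¹ * (J * W)` say that the block of
  -- `J⁻¹` is a left inverse of `H`.
  let W : Matrix (m ⊕ n) m ℝ := Matrix.of fun p j =>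
    Sum.elim (fun i => if i = j then 1 else 0) (fun l => -Z j l) p
  have hJW : J * W = Matrix.of fun p j => B (t p) (r j) := by
    ext p j
    have : r j = t (Sum.inl j) - ∑ l, Z j l • t (Sum.inr l) := by rw [hZ]; abel
    simp only [Matrix.mul_apply, Matrix.of_apply]
    rw [Fintype.sum_sum_type, this, map_sub, map_sum]
    simp [W, hJ, sub_eq_add_neg, mul_comm]
  have hW : W = J⁻¹ * Matrix.of fun p j => B (t p) (r j) := by
    rw [← hJW, ← Matrix.mul_assoc, Matrix.nonsing_inv_mul _ hJdet, Matrix.one_mul]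
  refine (Matrix.inv_eq_left_inv ?_).symm
  ext i j
  have := congrFun (congrFun hW (Sum.inl i)) j
  rw [Matrix.mul_apply, Fintype.sum_sum_type] at this
  simp only [Matrix.of_apply, horth, mul_zero, Finset.sum_const_zero, add_zero, ← hH] at this
  rw [Matrix.mul_apply, Matrix.one_apply]
  exact this.symm

/-! ### The Fisher information as a Gram matrix -/

/-- The real inner product of two complex vectors. -/
def reInner {κ : Type*} [Fintype κ] (v w : κ → ℂ) : ℝ := (star v ⬝ᵥ w).re

section reInner

variable {κ : Type*} [Fintype κ] (v v' w : κ → ℂ) (r : ℝ)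

theorem reInner_eq_sum : reInner v w = ∑ a, ((v a).re * (w a).re + (v a).im * (w a).im) := by
  simp [reInner, dotProduct, Complex.re_sum]

theorem reInner_comm : reInner v w = reInner w v := by
  simp only [reInner_eq_sum, mul_comm]

theorem reInner_add_left : reInner (v + v') w = reInner v w + reInner v' w := by
  simp only [reInner_eq_sum, ← Finset.sum_add_distrib]
  exact Finset.sum_congr rfl fun a _ => by simp; ring

theorem reInner_smul_left : reInner (r • v) w = r * reInner v w := by
  simp only [reInner_eq_sum, Finset.mul_sum]
  exact Finset.sum_congr rfl fun a _ => by simp; ring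

theorem reInner_add_right : reInner w (v + v') = reInner w v + reInner w v' := by
  simp only [reInner_comm w, reInner_add_left]

theorem reInner_smul_right : reInner w (r • v) = r * reInner w v := by
  simp only [reInner_comm w, reInner_smul_left]

theorem reInner_sub_right : reInner w (v - v') = reInner w v - reInner w v' := by
  rw [sub_eq_add_neg, reInner_add_right, ← neg_one_smul ℝ v', reInner_smul_right]; ring

theorem reInner_zero_left : reInner 0 w = 0 := by simp [reInner]

theorem reInner_zero_right : reInner w 0 = 0 := by simp [reInner]

theorem reInner_self_eq_zero (h : reInner v v = 0) : v = 0 := by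
  rw [reInner_eq_sum, Finset.sum_eq_zero_iff_of_nonneg fun a _ =>
    add_nonneg (mul_self_nonneg _) (mul_self_nonneg _)] at h
  ext a
  have := h a (Finset.mem_univ a)
  apply Complex.ext <;> simp <;> nlinarith [sq_nonneg (v a).re, sq_nonneg (v a).im]

end reInner

/-- The bilinear form whose Gram matrix on the derivatives of (mean, noise power) is the Fisher
information of a model with covariance `σ² I`. -/
def infoForm (κ : Type*) [Fintype κ] (σ2 : ℝ) : LinearMap.BilinForm ℝ ((κ → ℂ) × ℝ) :=
  LinearMap.mk₂ ℝ
    (fun x y => 2 / σ2 * reInner x.1 y.1 + Fintype.card κ / σ2 ^ 2 * (x.2 * y.2))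
    (fun x x' y => by simp [reInner_add_left]; ring)
    (fun r x y => by simp [reInner_smul_left]; ring)
    (fun x y y' => by simp [reInner_add_right]; ring)
    (fun r x y => by simp [reInner_smul_right]; ring)

theorem infoForm_apply {κ : Type*} [Fintype κ] (σ2 : ℝ) (x y : (κ → ℂ) × ℝ) :
    infoForm κ σ2 x y =
      2 / σ2 * reInner x.1 y.1 + Fintype.card κ / σ2 ^ 2 * (x.2 * y.2) := rfl

theorem infoForm_definite {κ : Type*} [Fintype κ] [Nonempty κ] {σ2 : ℝ} (hσ : 0 < σ2)
    (x : (κ → ℂ) × ℝ) (h : infoForm κ σ2 x x = 0) : x = 0 := by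
  rw [infoForm_apply] at h
  have h1 : 0 ≤ reInner x.1 x.1 := by
    rw [reInner_eq_sum]
    exact Finset.sum_nonneg fun a _ => add_nonneg (mul_self_nonneg _) (mul_self_nonneg _)
  have hc : (0 : ℝ) < Fintype.card κ := by exact_mod_cast Fintype.card_pos
  have h2 : 0 ≤ 2 / σ2 * reInner x.1 x.1 := by positivity
  have h3 : 0 ≤ Fintype.card κ / σ2 ^ 2 * (x.2 * x.2) :=
    mul_nonneg (by positivity) (mul_self_nonneg _)
  have h4 : reInner x.1 x.1 = 0 := by
    have : 2 / σ2 * reInner x.1 x.1 = 0 := by linarith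
    rcases mul_eq_zero.1 this with h | h
    · exact absurd h (by positivity)
    · exact h
  have h5 : x.2 * x.2 = 0 := by
    have : Fintype.card κ / σ2 ^ 2 * (x.2 * x.2) = 0 := by linarith
    rcases mul_eq_zero.1 this with h | h
    · exact absurd h (by positivity)
    · exact h
  exact Prod.ext (reInner_self_eq_zero _ h4) (mul_self_eq_zero.1 h5)

/-- Only the coordinate `s` moves the covariance, so the trace term lives on the entry (s, s), where
it is card κ/σ⁴. The second component of the tangent records exactly this. -/
theorem fisherInfo_eq_infoForm {ι κ : Type*} [DecidableEq ι] [Fintype κ] [DecidableEq κ]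
    (ν : (ι → ℝ) → κ → ℂ) (s : ι) (ξ : ι → ℝ) (hσ : ξ s ≠ 0) (p q : ι) :
    fisherInfo ν (fun ζ => ((ζ s : ℝ) : ℂ) • (1 : Matrix κ κ ℂ)) ξ p q =
      infoForm κ (ξ s) (fun a => pderiv p (fun ζ => ν ζ a) ξ, (Pi.single p 1 : ι → ℝ) s)
        (fun a => pderiv q (fun ζ => ν ζ a) ξ, (Pi.single q 1 : ι → ℝ) s) := by
  have hV : ∀ p : ι, Matrix.of (fun a b : κ =>
      pderiv p (fun ζ => (((ζ s : ℝ) : ℂ) • (1 : Matrix κ κ ℂ)) a b) ξ) =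
      (((Pi.single p 1 : ι → ℝ) s : ℝ) : ℂ) • (1 : Matrix κ κ ℂ) := by
    intro p
    ext a b
    simp only [Matrix.of_apply, Matrix.smul_apply, pderiv, smul_eq_mul]
    have h1 := (hasDerivAt_pi.1 (hasDerivAt_update ξ p (ξ p))) s
    exact (h1.ofReal_comp.mul_const _).deriv
  have hinv : (((ξ s : ℝ) : ℂ) • (1 : Matrix κ κ ℂ))⁻¹ = ((ξ s)⁻¹ : ℂ) • (1 : Matrix κ κ ℂ) := by
    apply Matrix.inv_eq_left_inv
    have : ((ξ s : ℝ) : ℂ) ≠ 0 := by exact_mod_cast hσ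
    rw [Matrix.smul_mul, Matrix.one_mul, smul_smul, inv_mul_cancel₀ this, one_smul]
  rw [fisherInfo, Matrix.of_apply, hV, hV, hinv, infoForm_apply, add_comm]
  congr 1
  · simp only [Matrix.smul_mulVec, Matrix.one_mulVec, dotProduct_smul, smul_eq_mul, reInner]
    rw [← Complex.ofReal_inv, Complex.re_ofReal_mul]
    ring
  · simp only [Matrix.mul_smul, Matrix.mul_one, Matrix.trace_smul,
      Matrix.trace_one, smul_eq_mul]
    rw [← Complex.ofReal_inv, ← Complex.ofReal_natCast, ← Complex.ofReal_mul,
      ← Complex.ofReal_mul, ← Complex.ofReal_mul, ← Complex.ofReal_mul, Complex.ofReal_re]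
    field_simp


/-! ### Derivatives of the mean -/

/-- Position of sensor `m` relative to the array centroid. -/
def arrayPos (M : ℕ) (m : Fin M) : ℝ := (m : ℝ) - ((M : ℝ) - 1) / 2

/-- The steering vector of the centred array at frequency `μ`, rotated by the phase `θ`. -/
def steer (M : ℕ) (θ μ : ℝ) (m : Fin M) : ℂ :=
  Complex.exp (Complex.I * ((θ + arrayPos M m * μ : ℝ) : ℂ))

/-- The vectorised outer product of a complex array vector and a real signal. -/
def outer {M N : ℕ} (v : Fin M → ℂ) (f : Fin N → ℝ) (a : Fin M × Fin N) : ℂ := v a.1 * (f a.2 : ℂ)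

theorem hasDerivAt_update_apply {ι : Type*} [Fintype ι] [DecidableEq ι] (ξ : ι → ℝ) (p q : ι) :
    HasDerivAt (fun x => ((Function.update ξ p x q : ℝ) : ℂ))
      (((Pi.single p 1 : ι → ℝ) q : ℝ) : ℂ) (ξ p) :=
  ((hasDerivAt_pi.1 (hasDerivAt_update ξ p (ξ p))) q).ofReal_comp

theorem symbols_apply {d N : ℕ} (φ : Fin d → ℝ) (S₀ : Matrix (Fin d) (Fin N) ℝ) (l : Fin d)
    (t : Fin N) : symbols φ S₀ l t = Complex.exp (Complex.I * (φ l : ℂ)) * (S₀ l t : ℂ) := by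
  simp [symbols, phaseMatrix, Matrix.diagonal_mul]

/-- Coordinate `q` has derivative `Pi.single p 1 q` along `p`, so one product rule serves all kinds
of parameters and the case distinction is postponed. -/
theorem pderiv_arbMean (M : ℕ) (δ : ℝ) {d N : ℕ} (ξ : ArbParam d N → ℝ) (p : ArbParam d N)
    (a : Fin M × Fin N) :
    pderiv p (fun ζ => arbMean M δ ζ a) ξ = ∑ l,
      (Complex.exp (Complex.I * ((sensorPos M δ a.1 * ξ (Sum.inl l) : ℝ) : ℂ)) *
        (Complex.I * ((sensorPos M δ a.1 : ℂ) * ((Pi.single p 1 : ArbParam d N → ℝ) (Sum.inl l) : ℝ)))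
          * ((ξ (Sum.inr (Sum.inl (l, a.2))) : ℂ) +
            Complex.I * (ξ (Sum.inr (Sum.inr (Sum.inl (l, a.2)))) : ℂ)) +
      Complex.exp (Complex.I * ((sensorPos M δ a.1 * ξ (Sum.inl l) : ℝ) : ℂ)) *
        ((((Pi.single p 1 : ArbParam d N → ℝ) (Sum.inr (Sum.inl (l, a.2))) : ℝ) : ℂ) +
          Complex.I *
            (((Pi.single p 1 : ArbParam d N → ℝ) (Sum.inr (Sum.inr (Sum.inl (l, a.2)))) : ℝ) : ℂ))) := by
  rw [pderiv]
  simp only [arbMean, Matrix.mul_apply, steeringMatrix, Matrix.of_apply, Complex.ofReal_mul]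
  refine (HasDerivAt.fun_sum fun l _ => ?_).deriv
  have h1 := (((hasDerivAt_update_apply ξ p (Sum.inl l)).const_mul
    (sensorPos M δ a.1 : ℂ)).const_mul Complex.I).cexp
  have h2 := (hasDerivAt_update_apply ξ p (Sum.inr (Sum.inl (l, a.2)))).fun_add
    ((hasDerivAt_update_apply ξ p (Sum.inr (Sum.inr (Sum.inl (l, a.2))))).const_mul Complex.I)
  simpa using h1.fun_mul h2

theorem pderiv_ncMean (M : ℕ) (δ : ℝ) {d N : ℕ} (ξ : NCParam d N → ℝ) (p : NCParam d N)
    (a : Fin M × Fin N) :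
    pderiv p (fun ζ => ncMean M δ ζ a) ξ = ∑ l,
      (Complex.exp (Complex.I * ((sensorPos M δ a.1 * ξ (Sum.inl l) : ℝ) : ℂ)) *
        (Complex.I * ((sensorPos M δ a.1 : ℂ) * ((Pi.single p 1 : NCParam d N → ℝ) (Sum.inl l) : ℝ)))
          * (Complex.exp (Complex.I * (ξ (Sum.inr (Sum.inr (Sum.inl l))) : ℂ)) *
            (ξ (Sum.inr (Sum.inl (l, a.2))) : ℂ)) +
      Complex.exp (Complex.I * ((sensorPos M δ a.1 * ξ (Sum.inl l) : ℝ) : ℂ)) *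
        (Complex.exp (Complex.I * (ξ (Sum.inr (Sum.inr (Sum.inl l))) : ℂ)) *
          (Complex.I * (((Pi.single p 1 : NCParam d N → ℝ) (Sum.inr (Sum.inr (Sum.inl l))) : ℝ) : ℂ))
            * (ξ (Sum.inr (Sum.inl (l, a.2))) : ℂ) +
        Complex.exp (Complex.I * (ξ (Sum.inr (Sum.inr (Sum.inl l))) : ℂ)) *
          (((Pi.single p 1 : NCParam d N → ℝ) (Sum.inr (Sum.inl (l, a.2))) : ℝ) : ℂ))) := by
  rw [pderiv]
  simp only [ncMean, Matrix.mul_apply, symbols_apply, steeringMatrix, Matrix.of_apply,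
    Complex.ofReal_mul]
  refine (HasDerivAt.fun_sum fun l _ => ?_).deriv
  have h1 := (((hasDerivAt_update_apply ξ p (Sum.inl l)).const_mul
    (sensorPos M δ a.1 : ℂ)).const_mul Complex.I).cexp
  have h2 := ((hasDerivAt_update_apply ξ p (Sum.inr (Sum.inr (Sum.inl l)))).const_mul
    Complex.I).cexp.fun_mul (hasDerivAt_update_apply ξ p (Sum.inr (Sum.inl (l, a.2))))
  simpa using h1.fun_mul h2

theorem sensorPos_eq (M : ℕ) (δ : ℝ) (m : Fin M) : sensorPos M δ m = arrayPos M m + δ := rfl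

/-- Shifting the phase reference only adds the phase δμ to a source. The array may therefore be
centred, and this is where the term δ(μ₂-μ₁) of Δφ comes from. -/
theorem exp_sensorPos (M : ℕ) (δ μ : ℝ) (m : Fin M) :
    Complex.exp (Complex.I * ((sensorPos M δ m * μ : ℝ) : ℂ)) = steer M (δ * μ) μ m := by
  rw [steer, sensorPos_eq]; congr 3; ring

theorem steer_mul_exp (M : ℕ) (θ φ μ : ℝ) (m : Fin M) :
    steer M θ μ m * Complex.exp (Complex.I * (φ : ℂ)) = steer M (φ + θ) μ m := by
  rw [steer, steer, ← Complex.exp_add]; congr 1; push_cast; ring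

/-- The derivatives of the mean `A S` in direction of the signal and frequency parameters. -/
def arbTangent (M : ℕ) (δ : ℝ) {d N : ℕ} (μ : Fin d → ℝ) (S₀ : Matrix (Fin d) (Fin N) ℝ)
    (φ : Fin d → ℝ) : ArbParam d N → (Fin M × Fin N → ℂ) × ℝ
  | Sum.inl i => (outer (fun m => Complex.I * ((arrayPos M m + δ : ℝ) : ℂ) *
      steer M (φ i + δ * μ i) (μ i) m) (S₀ i), 0)
  | Sum.inr (Sum.inl p) => (outer (steer M (δ * μ p.1) (μ p.1)) (Pi.single p.2 1), 0)
  | Sum.inr (Sum.inr (Sum.inl p)) =>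
      (outer (Complex.I • steer M (δ * μ p.1) (μ p.1)) (Pi.single p.2 1), 0)
  | Sum.inr (Sum.inr (Sum.inr _)) => (0, 1)

/-- The derivatives of the mean `A Ψ S₀` in direction of all its parameters. -/
def ncTangent (M : ℕ) (δ : ℝ) {d N : ℕ} (μ : Fin d → ℝ) (S₀ : Matrix (Fin d) (Fin N) ℝ)
    (φ : Fin d → ℝ) : NCParam d N → (Fin M × Fin N → ℂ) × ℝ
  | Sum.inl i => (outer (fun m => Complex.I * ((arrayPos M m + δ : ℝ) : ℂ) *
      steer M (φ i + δ * μ i) (μ i) m) (S₀ i), 0)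
  | Sum.inr (Sum.inl p) => (outer (steer M (φ p.1 + δ * μ p.1) (μ p.1)) (Pi.single p.2 1), 0)
  | Sum.inr (Sum.inr (Sum.inl l)) =>
      (outer (Complex.I • steer M (φ l + δ * μ l) (μ l)) (S₀ l), 0)
  | Sum.inr (Sum.inr (Sum.inr _)) => (0, 1)

theorem fisherInfo_arb (M : ℕ) (δ : ℝ) {d N : ℕ} (μ : Fin d → ℝ) (S₀ : Matrix (Fin d) (Fin N) ℝ)
    (φ : Fin d → ℝ) {σ2 : ℝ} (hσ : 0 < σ2) (p q : ArbParam d N) :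
    fisherInfo (arbMean M δ) (arbCov M) (arbPoint μ (symbols φ S₀) σ2) p q =
      infoForm _ σ2 (arbTangent M δ μ S₀ φ p) (arbTangent M δ μ S₀ φ q) := by
  refine (fisherInfo_eq_infoForm (arbMean M δ) (Sum.inr (Sum.inr (Sum.inr ())))
    (arbPoint μ (symbols φ S₀) σ2) hσ.ne' p q).trans ?_
  have key : ∀ p : ArbParam d N,
      ((fun a => pderiv p (fun ζ => arbMean M δ ζ a) (arbPoint μ (symbols φ S₀) σ2),
        (Pi.single p 1 : ArbParam d N → ℝ) (Sum.inr (Sum.inr (Sum.inr ())))) :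
          (Fin M × Fin N → ℂ) × ℝ) = arbTangent M δ μ S₀ φ p := by
    intro p
    refine Prod.ext (funext fun a => ?_) ?_
    · simp only [pderiv_arbMean, exp_sensorPos]
      rcases p with i | ⟨l, t⟩ | ⟨l, t⟩ | u
      · have h : ∀ l, ((symbols φ S₀ l a.2).re : ℂ) + Complex.I * ((symbols φ S₀ l a.2).im : ℂ) =
            Complex.exp (Complex.I * (φ l : ℂ)) * (S₀ l a.2 : ℂ) := fun l => by
          rw [← symbols_apply, mul_comm, Complex.re_add_im]
        simp only [arbPoint, Sum.elim_inl, Sum.elim_inr, h, Pi.single_apply, Sum.inl.injEq,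
          reduceCtorEq, if_false, arbTangent, outer, ← sensorPos_eq, ← steer_mul_exp]
        rw [Finset.sum_eq_single i]
        · simp; ring
        · intro b _ hb; simp [hb]
        · simp
      · simp only [arbPoint, Sum.elim_inl, Sum.elim_inr, Pi.single_apply, Sum.inl.injEq,
          Sum.inr.injEq, Prod.mk.injEq, reduceCtorEq, if_false, arbTangent, outer]
        rw [Finset.sum_eq_single l]
        · simp
        · intro b _ hb; simp [hb]
        · simp
      · simp only [arbPoint, Sum.elim_inl, Sum.elim_inr, Pi.single_apply, Sum.inl.injEq,
          Sum.inr.injEq, Prod.mk.injEq, reduceCtorEq, if_false, arbTangent, outer]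
        rw [Finset.sum_eq_single l]
        · simp; ring
        · intro b _ hb; simp [hb]
        · simp
      · simp [arbTangent]
    · rcases p with i | ⟨l, t⟩ | ⟨l, t⟩ | u <;> simp [arbTangent]
  rw [key, key]
  rfl

theorem fisherInfo_nc (M : ℕ) (δ : ℝ) {d N : ℕ} (μ : Fin d → ℝ) (S₀ : Matrix (Fin d) (Fin N) ℝ)
    (φ : Fin d → ℝ) {σ2 : ℝ} (hσ : 0 < σ2) (p q : NCParam d N) :
    fisherInfo (ncMean M δ) (ncCov M) (ncPoint μ S₀ φ σ2) p q =
      infoForm _ σ2 (ncTangent M δ μ S₀ φ p) (ncTangent M δ μ S₀ φ q) := by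
  refine (fisherInfo_eq_infoForm (ncMean M δ) (Sum.inr (Sum.inr (Sum.inr ())))
    (ncPoint μ S₀ φ σ2) hσ.ne' p q).trans ?_
  have key : ∀ p : NCParam d N,
      ((fun a => pderiv p (fun ζ => ncMean M δ ζ a) (ncPoint μ S₀ φ σ2),
        (Pi.single p 1 : NCParam d N → ℝ) (Sum.inr (Sum.inr (Sum.inr ())))) :
          (Fin M × Fin N → ℂ) × ℝ) = ncTangent M δ μ S₀ φ p := by
    intro p
    refine Prod.ext (funext fun a => ?_) ?_
    · simp only [pderiv_ncMean, exp_sensorPos]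
      rcases p with i | ⟨l, t⟩ | l | u
      · simp only [ncPoint, Sum.elim_inl, Sum.elim_inr, Pi.single_apply, Sum.inl.injEq,
          reduceCtorEq, if_false, ncTangent, outer, ← sensorPos_eq, ← steer_mul_exp]
        rw [Finset.sum_eq_single i]
        · simp; ring
        · intro b _ hb; simp [hb]
        · simp
      · simp only [ncPoint, Sum.elim_inl, Sum.elim_inr, Pi.single_apply, Sum.inl.injEq,
          Sum.inr.injEq, Prod.mk.injEq, reduceCtorEq, if_false, ncTangent, outer, ← steer_mul_exp]
        rw [Finset.sum_eq_single l]
        · simp; ring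
        · intro b _ hb; simp [hb]
        · simp
      · simp only [ncPoint, Sum.elim_inl, Sum.elim_inr, Pi.single_apply, Sum.inl.injEq,
          Sum.inr.injEq, reduceCtorEq, if_false, ncTangent, outer, ← steer_mul_exp, Pi.smul_apply]
        rw [Finset.sum_eq_single l]
        · simp; ring
        · intro b _ hb; simp [hb]
        · simp
      · simp [ncTangent]
    · rcases p with i | ⟨l, t⟩ | l | u <;> simp [ncTangent]
  rw [key, key]
  rfl


/-! ### Inner products of steering vectors and their derivatives -/

/-- `∑ cos (k x)` over the centred sensor positions `k`. -/
def cosSum (M : ℕ) (x : ℝ) : ℝ := ∑ m, Real.cos (arrayPos M m * x)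

/-- `∑ k sin (k x)` over the centred sensor positions `k`. -/
def sinSum (M : ℕ) (x : ℝ) : ℝ := ∑ m, arrayPos M m * Real.sin (arrayPos M m * x)

/-- `∑ k²` over the centred sensor positions `k`. -/
def sqSum (M : ℕ) : ℝ := ∑ m, arrayPos M m ^ 2

/-- `∑ k² cos (k x)` over the centred sensor positions `k`. -/
def sqCosSum (M : ℕ) (x : ℝ) : ℝ := ∑ m, arrayPos M m ^ 2 * Real.cos (arrayPos M m * x)

/-- The squared norm of the steering vector derivative after projection onto the complement of the
two steering vectors at distance `x`. -/
def projPow (M : ℕ) (x : ℝ) : ℝ := sqSum M - sinSum M x ^ 2 * M / (M ^ 2 - cosSum M x ^ 2)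

/-- The inner product of the two steering vector derivatives after projection onto the complement
of the two steering vectors at distance `x`. -/
def projCross (M : ℕ) (x : ℝ) : ℝ :=
  sqCosSum M x - sinSum M x ^ 2 * cosSum M x / (M ^ 2 - cosSum M x ^ 2)

theorem arrayPos_rev (M : ℕ) (m : Fin M) : arrayPos M m.rev = -arrayPos M m := by
  have : ((m.rev : ℕ) : ℝ) = M - (m + 1) := by
    rw [Fin.val_rev, Nat.cast_sub (by omega)]; push_cast; ring
  rw [arrayPos, arrayPos, this]; ring

/-- Reversing the centred array negates every position. This makes the inner products below products
of a function of the frequency difference and one of the phase difference. -/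
theorem sum_arrayPos_odd (M : ℕ) (f : ℝ → ℝ) (hf : ∀ x, f (-x) = -f x) :
    ∑ m, f (arrayPos M m) = 0 := by
  have : ∑ m, f (arrayPos M m) = ∑ m, f (arrayPos M (Fin.rev m)) :=
    (Equiv.sum_comp Fin.revPerm fun m => f (arrayPos M m)).symm
  simp only [arrayPos_rev, hf, Finset.sum_neg_distrib] at this
  linarith

theorem sum_mul_cos_add_even (M : ℕ) (f : ℝ → ℝ) (hf : ∀ x, f (-x) = f x) (ψ x : ℝ) :
    ∑ m, f (arrayPos M m) * Real.cos (ψ + arrayPos M m * x) =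
      (∑ m, f (arrayPos M m) * Real.cos (arrayPos M m * x)) * Real.cos ψ := by
  have h := sum_arrayPos_odd M (fun k => f k * Real.sin (k * x)) fun k => by
    rw [hf, neg_mul, Real.sin_neg]; ring
  simp only [Real.cos_add, mul_sub, Finset.sum_sub_distrib, Finset.sum_mul]
  rw [show ∑ m, f (arrayPos M m) * (Real.sin ψ * Real.sin (arrayPos M m * x)) = 0 by
    rw [← mul_zero (Real.sin ψ), ← h, Finset.mul_sum]
    exact Finset.sum_congr rfl fun _ _ => by ring]
  rw [sub_zero]
  exact Finset.sum_congr rfl fun _ _ => by ring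

theorem sum_mul_cos_add_odd (M : ℕ) (f : ℝ → ℝ) (hf : ∀ x, f (-x) = -f x) (ψ x : ℝ) :
    ∑ m, f (arrayPos M m) * Real.cos (ψ + arrayPos M m * x) =
      -(∑ m, f (arrayPos M m) * Real.sin (arrayPos M m * x)) * Real.sin ψ := by
  have h := sum_arrayPos_odd M (fun k => f k * Real.cos (k * x)) fun k => by
    rw [hf, neg_mul k, Real.cos_neg, neg_mul]
  simp only [Real.cos_add, mul_sub, Finset.sum_sub_distrib, neg_mul, Finset.sum_mul]
  rw [show ∑ m, f (arrayPos M m) * (Real.cos ψ * Real.cos (arrayPos M m * x)) = 0 by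
    rw [← mul_zero (Real.cos ψ), ← h, Finset.mul_sum]
    exact Finset.sum_congr rfl fun _ _ => by ring]
  rw [zero_sub]
  exact congrArg _ (Finset.sum_congr rfl fun _ _ => by ring)

theorem sum_mul_sin_add_even (M : ℕ) (f : ℝ → ℝ) (hf : ∀ x, f (-x) = f x) (ψ x : ℝ) :
    ∑ m, f (arrayPos M m) * Real.sin (ψ + arrayPos M m * x) =
      (∑ m, f (arrayPos M m) * Real.cos (arrayPos M m * x)) * Real.sin ψ := by
  have h := sum_mul_cos_add_even M f hf (ψ - Real.pi / 2) x
  rw [Real.cos_sub_pi_div_two] at h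
  rw [← h]
  refine Finset.sum_congr rfl fun m _ => ?_
  rw [← Real.cos_sub_pi_div_two]; congr 2; ring

theorem sum_mul_sin_add_odd (M : ℕ) (f : ℝ → ℝ) (hf : ∀ x, f (-x) = -f x) (ψ x : ℝ) :
    ∑ m, f (arrayPos M m) * Real.sin (ψ + arrayPos M m * x) =
      (∑ m, f (arrayPos M m) * Real.sin (arrayPos M m * x)) * Real.cos ψ := by
  have h := sum_mul_cos_add_odd M f hf (ψ - Real.pi / 2) x
  rw [Real.sin_sub_pi_div_two] at h
  rw [neg_mul_neg] at h
  rw [← h]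
  refine Finset.sum_congr rfl fun m _ => ?_
  rw [← Real.cos_sub_pi_div_two]; congr 2; ring

/-- The derivative of the (rotated) steering vector of the centred array. -/
def steerDeriv (M : ℕ) (θ μ : ℝ) (m : Fin M) : ℂ :=
  Complex.I * ((arrayPos M m : ℂ) * steer M θ μ m)

theorem steer_re (M : ℕ) (θ μ : ℝ) (m : Fin M) :
    (steer M θ μ m).re = Real.cos (θ + arrayPos M m * μ) := by
  rw [steer, mul_comm, Complex.exp_ofReal_mul_I_re]

theorem steer_im (M : ℕ) (θ μ : ℝ) (m : Fin M) :
    (steer M θ μ m).im = Real.sin (θ + arrayPos M m * μ) := by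
  rw [steer, mul_comm, Complex.exp_ofReal_mul_I_im]

theorem steerDeriv_re (M : ℕ) (θ μ : ℝ) (m : Fin M) :
    (steerDeriv M θ μ m).re = -(arrayPos M m * Real.sin (θ + arrayPos M m * μ)) := by
  rw [steerDeriv, Complex.I_mul_re, Complex.im_ofReal_mul, steer_im]

theorem steerDeriv_im (M : ℕ) (θ μ : ℝ) (m : Fin M) :
    (steerDeriv M θ μ m).im = arrayPos M m * Real.cos (θ + arrayPos M m * μ) := by
  rw [steerDeriv, Complex.I_mul_im, Complex.re_ofReal_mul, steer_re]

section inner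

variable (M : ℕ) (θ θ' μ μ' : ℝ)

theorem reInner_steer_steer : reInner (steer M θ μ) (steer M θ' μ') =
    cosSum M (μ' - μ) * Real.cos (θ' - θ) := by
  have := sum_mul_cos_add_even M (fun _ => 1) (fun _ => rfl) (θ' - θ) (μ' - μ)
  simp only [one_mul] at this
  rw [cosSum, ← this, reInner_eq_sum]
  refine Finset.sum_congr rfl fun m _ => ?_
  rw [steer_re, steer_re, steer_im, steer_im, show θ' - θ + arrayPos M m * (μ' - μ) =
    (θ' + arrayPos M m * μ') - (θ + arrayPos M m * μ) by ring, Real.cos_sub]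
  ring

theorem reInner_I_smul_I_smul {κ : Type*} [Fintype κ] (v w : κ → ℂ) :
    reInner (Complex.I • v) (Complex.I • w) = reInner v w := by
  simp only [reInner_eq_sum]
  refine Finset.sum_congr rfl fun m _ => ?_
  simp only [Pi.smul_apply, smul_eq_mul, Complex.I_mul_re, Complex.I_mul_im]
  ring

theorem reInner_steer_I_steer : reInner (steer M θ μ) (Complex.I • steer M θ' μ') =
    -(cosSum M (μ' - μ) * Real.sin (θ' - θ)) := by
  have := sum_mul_sin_add_even M (fun _ => 1) (fun _ => rfl) (θ' - θ) (μ' - μ)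
  simp only [one_mul] at this
  rw [cosSum, ← this, reInner_eq_sum, ← Finset.sum_neg_distrib]
  refine Finset.sum_congr rfl fun m _ => ?_
  simp only [Pi.smul_apply, smul_eq_mul, Complex.I_mul_re, Complex.I_mul_im]
  rw [steer_re, steer_re, steer_im, steer_im, show θ' - θ + arrayPos M m * (μ' - μ) =
    (θ' + arrayPos M m * μ') - (θ + arrayPos M m * μ) by ring, Real.sin_sub]
  ring

theorem reInner_steer_steerDeriv : reInner (steer M θ μ) (steerDeriv M θ' μ') =
    -(sinSum M (μ' - μ) * Real.cos (θ' - θ)) := by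
  have := sum_mul_sin_add_odd M (fun k => k) (fun _ => rfl) (θ' - θ) (μ' - μ)
  rw [sinSum, ← this, reInner_eq_sum, ← Finset.sum_neg_distrib]
  refine Finset.sum_congr rfl fun m _ => ?_
  rw [steer_re, steer_im, steerDeriv_re, steerDeriv_im, show θ' - θ + arrayPos M m * (μ' - μ) =
    (θ' + arrayPos M m * μ') - (θ + arrayPos M m * μ) by ring, Real.sin_sub]
  ring

theorem reInner_I_steer_steerDeriv : reInner (Complex.I • steer M θ μ) (steerDeriv M θ' μ') =
    -(sinSum M (μ' - μ) * Real.sin (θ' - θ)) := by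
  have := sum_mul_cos_add_odd M (fun k => k) (fun _ => rfl) (θ' - θ) (μ' - μ)
  rw [sinSum, ← neg_mul, ← this, reInner_eq_sum]
  refine Finset.sum_congr rfl fun m _ => ?_
  simp only [Pi.smul_apply, smul_eq_mul, Complex.I_mul_re, Complex.I_mul_im]
  rw [steer_re, steer_im, steerDeriv_re, steerDeriv_im, show θ' - θ + arrayPos M m * (μ' - μ) =
    (θ' + arrayPos M m * μ') - (θ + arrayPos M m * μ) by ring, Real.cos_sub]
  ring

theorem reInner_steerDeriv_steerDeriv : reInner (steerDeriv M θ μ) (steerDeriv M θ' μ') =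
    sqCosSum M (μ' - μ) * Real.cos (θ' - θ) := by
  have := sum_mul_cos_add_even M (fun k => k ^ 2) (fun _ => neg_sq _) (θ' - θ) (μ' - μ)
  rw [sqCosSum, ← this, reInner_eq_sum]
  refine Finset.sum_congr rfl fun m _ => ?_
  rw [steerDeriv_re, steerDeriv_im, steerDeriv_re, steerDeriv_im,
    show θ' - θ + arrayPos M m * (μ' - μ) =
    (θ' + arrayPos M m * μ') - (θ + arrayPos M m * μ) by ring, Real.cos_sub]
  ring

end inner

theorem cosSum_zero (M : ℕ) : cosSum M 0 = M := by simp [cosSum]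

theorem sinSum_zero (M : ℕ) : sinSum M 0 = 0 := by simp [sinSum]

theorem sqCosSum_zero (M : ℕ) : sqCosSum M 0 = sqSum M := by simp [sqCosSum, sqSum]

theorem cosSum_neg (M : ℕ) (x : ℝ) : cosSum M (-x) = cosSum M x := by simp [cosSum]

theorem sinSum_neg (M : ℕ) (x : ℝ) : sinSum M (-x) = -sinSum M x := by simp [sinSum]

theorem sqCosSum_neg (M : ℕ) (x : ℝ) : sqCosSum M (-x) = sqCosSum M x := by simp [sqCosSum]

/-- The real Gram matrix of two rotated steering vectors `a`, of `I • a`, and of the derivatives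
`w` of `a`. -/
structure SteeringGram {κ : Type*} [Fintype κ] (a w : Fin 2 → κ → ℂ) (M c s p q C S : ℝ) :
    Prop where
  aa : ∀ i, reInner (a i) (a i) = M
  aa01 : reInner (a 0) (a 1) = c * C
  aa10 : reInner (a 1) (a 0) = c * C
  uu : ∀ i, reInner (Complex.I • a i) (Complex.I • a i) = M
  uu01 : reInner (Complex.I • a 0) (Complex.I • a 1) = c * C
  uu10 : reInner (Complex.I • a 1) (Complex.I • a 0) = c * C
  au : ∀ i, reInner (a i) (Complex.I • a i) = 0
  au01 : reInner (a 0) (Complex.I • a 1) = -(c * S)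
  au10 : reInner (a 1) (Complex.I • a 0) = c * S
  ua : ∀ i, reInner (Complex.I • a i) (a i) = 0
  ua01 : reInner (Complex.I • a 0) (a 1) = c * S
  ua10 : reInner (Complex.I • a 1) (a 0) = -(c * S)
  ww : ∀ i, reInner (w i) (w i) = p
  ww01 : reInner (w 0) (w 1) = q * C
  ww10 : reInner (w 1) (w 0) = q * C
  aw : ∀ i, reInner (a i) (w i) = 0
  aw01 : reInner (a 0) (w 1) = -(s * C)
  aw10 : reInner (a 1) (w 0) = s * C
  wa : ∀ i, reInner (w i) (a i) = 0
  wa01 : reInner (w 0) (a 1) = s * C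
  wa10 : reInner (w 1) (a 0) = -(s * C)
  uw : ∀ i, reInner (Complex.I • a i) (w i) = 0
  uw01 : reInner (Complex.I • a 0) (w 1) = -(s * S)
  uw10 : reInner (Complex.I • a 1) (w 0) = -(s * S)
  wu : ∀ i, reInner (w i) (Complex.I • a i) = 0
  wu01 : reInner (w 0) (Complex.I • a 1) = -(s * S)
  wu10 : reInner (w 1) (Complex.I • a 0) = -(s * S)
  trig : S ^ 2 + C ^ 2 = 1

/-- From here on the geometry of the array enters the projections only through seven real numbers,
so computing the projections becomes polynomial algebra with S² + C² = 1. -/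
theorem steeringGram (M : ℕ) (θ μ : Fin 2 → ℝ) :
    SteeringGram (fun i => steer M (θ i) (μ i)) (fun i => steerDeriv M (θ i) (μ i)) M
      (cosSum M (μ 1 - μ 0)) (sinSum M (μ 1 - μ 0)) (sqSum M) (sqCosSum M (μ 1 - μ 0))
      (Real.cos (θ 1 - θ 0)) (Real.sin (θ 1 - θ 0)) := by
  have hc : cosSum M (μ 0 - μ 1) = cosSum M (μ 1 - μ 0) := by rw [← cosSum_neg, neg_sub]
  have hs : sinSum M (μ 0 - μ 1) = -sinSum M (μ 1 - μ 0) := by rw [← sinSum_neg, neg_sub]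
  have hq : sqCosSum M (μ 0 - μ 1) = sqCosSum M (μ 1 - μ 0) := by rw [← sqCosSum_neg, neg_sub]
  have hC : Real.cos (θ 0 - θ 1) = Real.cos (θ 1 - θ 0) := by rw [← Real.cos_neg, neg_sub]
  have hS : Real.sin (θ 0 - θ 1) = -Real.sin (θ 1 - θ 0) := by rw [← Real.sin_neg, neg_sub]
  constructor
  case trig => exact Real.sin_sq_add_cos_sq _
  all_goals try intro i
  all_goals first
    | rw [reInner_I_smul_I_smul, reInner_steer_steer]
    | rw [reInner_I_steer_steerDeriv]
    | rw [reInner_steer_I_steer]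
    | rw [reInner_steer_steer]
    | rw [reInner_steer_steerDeriv]
    | rw [reInner_steerDeriv_steerDeriv]
    | rw [reInner_comm, reInner_I_steer_steerDeriv]
    | rw [reInner_comm, reInner_steer_I_steer]
    | rw [reInner_comm, reInner_steer_steerDeriv]
  all_goals simp only [hc, hs, hq, hC, hS, sub_self, cosSum_zero, sinSum_zero, sqCosSum_zero,
    Real.cos_zero, Real.sin_zero]
  all_goals ring

/-- The real Gram matrix of a₀, Ia₀, a₁, Ia₁ has diagonal blocks M·1 and off-diagonal blocks c times
a rotation. Eliminating one block leaves the scalar M² - c². -/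
theorem SteeringGram.independent {κ : Type*} [Fintype κ] {a w : Fin 2 → κ → ℂ}
    {M c s p q C S : ℝ} (h : SteeringGram a w M c s p q C S) (hc : c ^ 2 < M ^ 2)
    (z : Fin 2 → ℂ) (hz : ∑ l, z l • a l = 0) : z = 0 := by
  have hM : M ≠ 0 := by rintro rfl; nlinarith [sq_nonneg c]
  have expand : ∀ v, (z 0).re * reInner v (a 0) + (z 0).im * reInner v (Complex.I • a 0) +
      ((z 1).re * reInner v (a 1) + (z 1).im * reInner v (Complex.I • a 1)) = 0 := by
    intro v
    have : reInner v (∑ l, z l • a l) = 0 := by rw [hz, reInner_zero_right]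
    have hsplit : ∀ l, z l • a l = (z l).re • a l + (z l).im • (Complex.I • a l) := by
      intro l; ext m
      simp only [Pi.add_apply, Pi.smul_apply, smul_eq_mul, Complex.real_smul]
      conv_lhs => rw [← Complex.re_add_im (z l)]
      ring
    rw [Fin.sum_univ_two, hsplit, hsplit, reInner_add_right, reInner_add_right, reInner_add_right,
      reInner_smul_right, reInner_smul_right, reInner_smul_right, reInner_smul_right] at this
    exact this
  have e1 := expand (a 0)
  have e2 := expand (Complex.I • a 0)
  have e3 := expand (a 1)
  have e4 := expand (Complex.I • a 1)
  simp only [h.aa, h.aa01, h.aa10, h.au, h.au01, h.au10, h.ua, h.ua01, h.ua10, h.uu, h.uu01,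
    h.uu10] at e1 e2 e3 e4
  have hd : M ^ 2 - c ^ 2 ≠ 0 := by linarith
  have key : ∀ x, (M ^ 2 - c ^ 2) * x = 0 → x = 0 := fun x hx => (mul_eq_zero.1 hx).resolve_left hd
  have x0 : (z 0).re = 0 := key _ (by
    linear_combination M * e1 - c * C * e3 + c * S * e4 + c ^ 2 * (z 0).re * h.trig)
  have y0 : (z 0).im = 0 := key _ (by
    linear_combination M * e2 - c * S * e3 - c * C * e4 + c ^ 2 * (z 0).im * h.trig)
  have x1 : (z 1).re = 0 := key _ (by
    linear_combination M * e3 - c * C * e1 - c * S * e2 + c ^ 2 * (z 1).re * h.trig)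
  have y1 : (z 1).im = 0 := key _ (by
    linear_combination M * e4 + c * S * e1 - c * C * e2 + c ^ 2 * (z 1).im * h.trig)
  ext l
  fin_cases l
  · exact Complex.ext x0 y0
  · exact Complex.ext x1 y1


/-! ### Projections -/

/-- `w` minus a combination of the vectors `a l` and `I • a l`. -/
def residual {κ : Type*} (a : Fin 2 → κ → ℂ) (w : κ → ℂ) (x y : Fin 2 → ℝ) : κ → ℂ :=
  w - ((x 0 • a 0 + y 0 • (Complex.I • a 0)) + (x 1 • a 1 + y 1 • (Complex.I • a 1)))

theorem reInner_residual {κ : Type*} [Fintype κ] (a : Fin 2 → κ → ℂ) (v w : κ → ℂ)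
    (x y : Fin 2 → ℝ) : reInner v (residual a w x y) = reInner v w -
      ((x 0 * reInner v (a 0) + y 0 * reInner v (Complex.I • a 0)) +
        (x 1 * reInner v (a 1) + y 1 * reInner v (Complex.I • a 1))) := by
  simp only [residual, reInner_sub_right, reInner_add_right, reInner_smul_right]

namespace SteeringGram

variable {κ : Type*} [Fintype κ] {a w : Fin 2 → κ → ℂ} {M c s p q C S : ℝ}

theorem exists_residual (h : SteeringGram a w M c s p q C S) (hc : c ^ 2 < M ^ 2) :
    ∃ x y : Fin 2 → Fin 2 → ℝ,
      (∀ l i, reInner (a l) (residual a (w i) (x i) (y i)) = 0) ∧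
      (∀ l i, reInner (Complex.I • a l) (residual a (w i) (x i) (y i)) = 0) ∧
      (∀ i j, reInner (w i) (residual a (w j) (x j) (y j)) =
        if i = j then p - s ^ 2 * M / (M ^ 2 - c ^ 2)
          else (q - s ^ 2 * c / (M ^ 2 - c ^ 2)) * C) := by
  have hd : M ^ 2 - c ^ 2 ≠ 0 := by linarith
  have hS : S ^ 2 = 1 - C ^ 2 := by linarith [h.trig]
  -- These solve the complex 2×2 normal equations, whose determinant is M² - c²; `x` holds the real
  -- and `y` the imaginary parts. For the derivative of the first steering vector, the coefficients
  -- are -sc and sM(C - jS), over M² - c².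
  refine ⟨fun i => ![![-(s * c), s * M * C], ![-(s * M * C), s * c]] i / fun _ => M ^ 2 - c ^ 2,
    fun i => ![![0, -(s * M * S)], ![-(s * M * S), 0]] i / fun _ => M ^ 2 - c ^ 2, ?_, ?_, ?_⟩
  all_goals
    intro i j
    rw [reInner_residual]
    fin_cases i <;> fin_cases j
    all_goals
      simp [h.aa, h.aa01, h.aa10, h.au, h.au01, h.au10, h.ua, h.ua01, h.ua10, h.uu, h.uu01,
        h.uu10, h.aw, h.aw01, h.aw10, h.uw, h.uw01, h.uw10, h.wa, h.wa01, h.wa10, h.wu, h.wu01,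
        h.wu10, h.ww, h.ww01, h.ww10]
      try field_simp
      try ring_nf
      try simp only [hS]
      try ring

/-- Projection in two stages: `x` and `x'` remove the real span of a₀, a₁ from the derivatives and
from the phase directions Ia_l, then `y` removes the phase directions that remain. In the second
stage the vectors carry the signals s_l, so each inner product is weighted by an entry of the
correlation matrix. -/
theorem exists_residual_nc (h : SteeringGram a w M c s p q C S) (hc : c ^ 2 < M ^ 2) {ρ : ℝ}
    (hρ : ρ ^ 2 ≤ 1) :
    ∃ x x' y : Fin 2 → Fin 2 → ℝ,
      (∀ l i, reInner (a l) (residual a (w i) (x i) 0) = 0) ∧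
      (∀ l i, reInner (a l) (residual a (Complex.I • a i) (x' i) 0) = 0) ∧
      (∀ l i, !![1, ρ; ρ, 1] l i * reInner (Complex.I • a l) (residual a (w i) (x i) 0) =
        ∑ j, y j i * (!![1, ρ; ρ, 1] l j *
          reInner (Complex.I • a l) (residual a (Complex.I • a j) (x' j) 0))) ∧
      (∀ i j, !![1, ρ; ρ, 1] i j * reInner (w i) (residual a (w j) (x j) 0) -
        ∑ l, y l j * (!![1, ρ; ρ, 1] i l *
          reInner (w i) (residual a (Complex.I • a l) (x' l) 0)) =
        if i = j then p - s ^ 2 * M / (M ^ 2 - c ^ 2) +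
            s ^ 2 * S ^ 2 * (1 - ρ ^ 2) * M ^ 2 / (M ^ 2 - c ^ 2) *
              (M / (M ^ 2 - ρ ^ 2 * c ^ 2 * C ^ 2))
          else ρ * (q - s ^ 2 * c / (M ^ 2 - c ^ 2)) * C -
            s ^ 2 * S ^ 2 * (1 - ρ ^ 2) * M ^ 2 / (M ^ 2 - c ^ 2) *
              (ρ * c * C / (M ^ 2 - ρ ^ 2 * c ^ 2 * C ^ 2))) := by
  have hd : M ^ 2 - c ^ 2 ≠ 0 := by linarith
  have hS : S ^ 2 = 1 - C ^ 2 := by linarith [h.trig]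
  have hC1 : C ^ 2 ≤ 1 := by nlinarith [h.trig]
  have hG : M ^ 2 - c ^ 2 * C ^ 2 ≠ 0 := by nlinarith [sq_nonneg c]
  have hT : M ^ 2 - ρ ^ 2 * c ^ 2 * C ^ 2 ≠ 0 := by
    have : ρ ^ 2 * C ^ 2 ≤ 1 := by nlinarith [sq_nonneg C, sq_nonneg ρ]
    nlinarith [sq_nonneg c]
  -- G is the determinant of the real Gram matrix of a₀, a₁. The weighted Gram matrix of the
  -- projected phase directions is (M²-c²)/G times the matrix with diagonal M and off-diagonal ρcC,
  -- whose determinant is T. Both are made opaque so that `field_simp` treats them as atoms.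
  obtain ⟨G, hGdef⟩ : ∃ G, G = M ^ 2 - c ^ 2 * C ^ 2 := ⟨_, rfl⟩
  obtain ⟨T, hTdef⟩ : ∃ T, T = M ^ 2 - ρ ^ 2 * c ^ 2 * C ^ 2 := ⟨_, rfl⟩
  rw [← hGdef] at hG
  rw [← hTdef] at hT
  rw [← hTdef]
  refine ⟨fun i => ![![-(s * C * (c * C)), s * C * M], ![-(s * C * M), s * C * (c * C)]] i /
      fun _ => G,
    fun i => ![![-(c * S * (c * C)), c * S * M], ![-(c * S * M), c * S * (c * C)]] i /
      fun _ => G,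
    fun i j => if i = j then -(s * S / (M ^ 2 - c ^ 2) * (c * C - ρ ^ 2 * (c * C) *
        (G) / (T)))
      else -(s * S / (M ^ 2 - c ^ 2) * (ρ * (G) * M /
        (T))), ?_, ?_, ?_, ?_⟩
  all_goals
    intro i j
    simp only [reInner_residual, Fin.sum_univ_two]
    fin_cases i <;> fin_cases j
    all_goals
      simp [h.aa, h.aa01, h.aa10, h.au, h.au01, h.au10, h.ua, h.ua01, h.ua10, h.uu, h.uu01,
        h.uu10, h.aw, h.aw01, h.aw10, h.uw, h.uw01, h.uw10, h.wa, h.wa01, h.wa10, h.wu, h.wu01,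
        h.wu10, h.ww, h.ww01, h.ww10]
      try field_simp
      try rw [hTdef]
      try rw [hGdef]
      try ring_nf
      try simp only [hS, show S ^ 3 = S * (1 - C ^ 2) by rw [← hS]; ring]
      try ring

end SteeringGram

/-- The symbol norms and the noise power split off as a factor that is the same for both bounds, and
so cancels in the gain. -/
theorem trace_inv_of_two {H : Matrix (Fin 2) (Fin 2) ℝ} {k x y : ℝ} {n : Fin 2 → ℝ}
    (hk : k ≠ 0) (hn : ∀ i, n i ≠ 0) (hxy : x ^ 2 - y ^ 2 ≠ 0)
    (hH : ∀ i j, H i j = k * (n i * n j * if i = j then x else y)) :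
    IsUnit H.det ∧ H⁻¹.trace = 1 / k * (1 / n 0 ^ 2 + 1 / n 1 ^ 2) * (x / (x ^ 2 - y ^ 2)) := by
  have hdet : H.det = k ^ 2 * (n 0 ^ 2 * n 1 ^ 2 * (x ^ 2 - y ^ 2)) := by
    rw [Matrix.det_fin_two, hH, hH, hH, hH]; simp; ring
  have h0 := hn 0
  have h1 := hn 1
  have hne : H.det ≠ 0 := by rw [hdet]; positivity
  refine ⟨isUnit_iff_ne_zero.2 hne, ?_⟩
  rw [Matrix.inv_def, Ring.inverse_eq_inv', Matrix.adjugate_fin_two, Matrix.trace_smul,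
    Matrix.trace_fin_two, hdet, hH, hH, hH, hH]
  simp
  field_simp


/-! ### The traces of the two Cramér-Rao bounds -/

section outer

variable {M N : ℕ}

theorem reInner_outer (v w : Fin M → ℂ) (f g : Fin N → ℝ) :
    reInner (outer v f) (outer w g) = reInner v w * (f ⬝ᵥ g) := by
  simp only [reInner_eq_sum, outer, dotProduct, Finset.sum_mul_sum, Fintype.sum_prod_type]
  refine Finset.sum_congr rfl fun m _ => Finset.sum_congr rfl fun t _ => ?_
  rw [Complex.re_mul_ofReal, Complex.re_mul_ofReal, Complex.im_mul_ofReal, Complex.im_mul_ofReal]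
  ring

theorem outer_add_left (v w : Fin M → ℂ) (f : Fin N → ℝ) :
    outer (v + w) f = outer v f + outer w f := by
  ext a; simp [outer, add_mul]

theorem outer_sub_left (v w : Fin M → ℂ) (f : Fin N → ℝ) :
    outer (v - w) f = outer v f - outer w f := by
  ext a; simp [outer, sub_mul]

theorem outer_smul_left (r : ℝ) (v : Fin M → ℂ) (f : Fin N → ℝ) :
    outer (r • v) f = r • outer v f := by
  ext a; simp [outer, mul_assoc]

theorem outer_eq_sum_single (v : Fin M → ℂ) (f : Fin N → ℝ) :
    outer v f = ∑ t, f t • outer v (Pi.single t 1) := by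
  ext a
  rw [Finset.sum_apply, Finset.sum_eq_single a.2]
  · simp [outer, mul_comm]
  · intro b _ hb; simp [outer, hb.symm]
  · simp

end outer

theorem ofReal_re_smul_add_im_smul {κ : Type*} (z : ℂ) (v : κ → ℂ) :
    z • v = z.re • v + z.im • (Complex.I • v) := by
  ext m
  simp only [Pi.add_apply, Pi.smul_apply, smul_eq_mul, Complex.real_smul]
  conv_lhs => rw [← Complex.re_add_im z]
  ring

/-- The second summand lies in the nuisance span of both models (a complex multiple of the steering
vector, or a phase direction), so δ affects the bounds only through the phases. -/
theorem derivative_eq_steerDeriv_add (M : ℕ) (δ θ μ : ℝ) :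
    (fun m => Complex.I * ((arrayPos M m + δ : ℝ) : ℂ) * steer M θ μ m) =
      steerDeriv M θ μ + δ • (Complex.I • steer M θ μ) := by
  ext m
  simp only [steerDeriv, Pi.add_apply, Pi.smul_apply, smul_eq_mul, Complex.real_smul]
  push_cast
  ring

theorem steer_add_phase (M : ℕ) (θ φ μ : ℝ) :
    steer M (φ + θ) μ = Complex.exp (Complex.I * (φ : ℂ)) • steer M θ μ := by
  ext m
  rw [← steer_mul_exp, Pi.smul_apply, smul_eq_mul, mul_comm]

section trace

variable {M N : ℕ} (δ : ℝ) {μ φ : Fin 2 → ℝ} {S₀ : Matrix (Fin 2) (Fin N) ℝ} {σ2 ρ : ℝ}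
  {n : Fin 2 → ℝ}

theorem linearIndependent_arbTangent (hc : cosSum M (μ 1 - μ 0) ^ 2 < (M : ℝ) ^ 2) :
    LinearIndependent ℝ (fun j => arbTangent M δ μ S₀ φ (Sum.inr j)) := by
  rw [Fintype.linearIndependent_iff]
  intro g hg
  simp only [Fintype.sum_sum_type, arbTangent] at hg
  have h2 := congrArg Prod.snd hg
  simp [Prod.snd_sum] at h2
  have h1 := congrArg Prod.fst hg
  have hz : ∀ t : Fin N, ∑ l, ((g (Sum.inl (l, t)) : ℂ) + g (Sum.inr (Sum.inl (l, t))) * Complex.I) •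
      steer M (δ * μ l) (μ l) = 0 := by
    intro t
    ext m
    have := congrFun h1 (m, t)
    simp only [Prod.fst_add, Prod.fst_sum, Prod.smul_fst, smul_zero, Finset.sum_const_zero,
      add_zero, Pi.add_apply, Finset.sum_apply, Fintype.sum_prod_type, Pi.smul_apply, outer,
      Prod.fst_zero, Pi.zero_apply] at this
    rw [← Finset.sum_add_distrib] at this
    rw [Finset.sum_apply, Pi.zero_apply, ← this]
    refine Finset.sum_congr rfl fun l _ => ?_
    rw [Finset.sum_eq_single t, Finset.sum_eq_single t]
    · simp; ring
    · intro b _ hb; simp [hb.symm]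
    · simp
    · intro b _ hb; simp [hb.symm]
    · simp
  -- At a fixed snapshot, a real relation between the signal tangents is a complex relation between
  -- the two steering vectors.
  have key := fun t => (steeringGram M (fun l => δ * μ l) μ).independent hc _ (hz t)
  intro p
  rcases p with ⟨l, t⟩ | ⟨l, t⟩ | u
  · simpa using congrArg Complex.re (congrFun (key t) l)
  · simpa using congrArg Complex.im (congrFun (key t) l)
  · exact h2

theorem linearIndependent_ncTangent (hc : cosSum M (μ 1 - μ 0) ^ 2 < (M : ℝ) ^ 2)
    (hS : ∀ i, S₀ i ≠ 0) :
    LinearIndependent ℝ (fun j => ncTangent M δ μ S₀ φ (Sum.inr j)) := by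
  rw [Fintype.linearIndependent_iff]
  intro g hg
  simp only [Fintype.sum_sum_type, ncTangent] at hg
  have h2 := congrArg Prod.snd hg
  simp [Prod.snd_sum] at h2
  have h1 := congrArg Prod.fst hg
  have hz : ∀ t : Fin N, ∑ l, ((g (Sum.inl (l, t)) : ℂ) +
      ((g (Sum.inr (Sum.inl l)) * S₀ l t : ℝ) : ℂ) * Complex.I) •
      steer M (φ l + δ * μ l) (μ l) = 0 := by
    intro t
    ext m
    have := congrFun h1 (m, t)
    simp only [Prod.fst_add, Prod.fst_sum, Prod.smul_fst, smul_zero, Finset.sum_const_zero,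
      add_zero, Pi.add_apply, Finset.sum_apply, Fintype.sum_prod_type, Pi.smul_apply, outer,
      Prod.fst_zero, Pi.zero_apply] at this
    rw [← Finset.sum_add_distrib] at this
    rw [Finset.sum_apply, Pi.zero_apply, ← this]
    refine Finset.sum_congr rfl fun l _ => ?_
    rw [Finset.sum_eq_single t]
    · simp; ring
    · intro b _ hb; simp [hb.symm]
    · simp
  have key := fun t => (steeringGram M (fun l => φ l + δ * μ l) μ).independent hc _ (hz t)
  intro p
  rcases p with ⟨l, t⟩ | l | u
  · simpa using congrArg Complex.re (congrFun (key t) l)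
  -- The phase coefficient appears multiplied by a symbol, so a snapshot with a nonzero symbol is
  -- needed to recover it.
  · obtain ⟨t, ht⟩ := Function.ne_iff.1 (hS l)
    have := congrArg Complex.im (congrFun (key t) l)
    simp only [Complex.add_im, Complex.ofReal_im, Complex.im_ofReal_mul, Complex.I_im, zero_add,
      mul_one, Pi.zero_apply, Complex.zero_im] at this
    exact (mul_eq_zero.1 this).resolve_right ht
  · exact h2

/-- The nuisance span contains every product of a complex multiple of a steering vector and a real
signal. The projection therefore acts on the array factor alone and leaves the signal s_i untouched.
-/
theorem trace_crb (hM : 0 < M) (hN : 0 < N) (hσ : 0 < σ2)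
    (hc : cosSum M (μ 1 - μ 0) ^ 2 < (M : ℝ) ^ 2) (hn : ∀ i, n i ≠ 0)
    (hS : ∀ i j, S₀ i ⬝ᵥ S₀ j = n i * n j * !![1, ρ; ρ, 1] i j)
    (hne : projPow M (μ 1 - μ 0) ^ 2 - (ρ * projCross M (μ 1 - μ 0) *
      Real.cos ((φ 1 + δ * μ 1) - (φ 0 + δ * μ 0))) ^ 2 ≠ 0) :
    (crb M δ μ (symbols φ S₀) σ2).trace = 1 / (2 / σ2) * (1 / n 0 ^ 2 + 1 / n 1 ^ 2) *
      (projPow M (μ 1 - μ 0) / (projPow M (μ 1 - μ 0) ^ 2 - (ρ * projCross M (μ 1 - μ 0) *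
        Real.cos ((φ 1 + δ * μ 1) - (φ 0 + δ * μ 0))) ^ 2)) := by
  have : Nonempty (Fin M × Fin N) := ⟨(⟨0, hM⟩, ⟨0, hN⟩)⟩
  have hG := steeringGram M (fun l => φ l + δ * μ l) μ
  obtain ⟨x, y, h1, h2, h3⟩ := hG.exists_residual hc
  set a : Fin 2 → Fin M → ℂ := fun i => steer M (φ i + δ * μ i) (μ i)
  set w : Fin 2 → Fin M → ℂ := fun i => steerDeriv M (φ i + δ * μ i) (μ i)
  let r : Fin 2 → Fin M → ℂ := fun i => residual a (w i) (x i) (y i)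
  let H : Matrix (Fin 2) (Fin 2) ℝ := Matrix.of fun i j =>
    infoForm _ σ2 (arbTangent M δ μ S₀ φ (Sum.inl i)) (outer (r j) (S₀ j), 0)
  have hH : ∀ i j, H i j = 2 / σ2 * (n i * n j * if i = j then projPow M (μ 1 - μ 0) else
      ρ * projCross M (μ 1 - μ 0) * Real.cos ((φ 1 + δ * μ 1) - (φ 0 + δ * μ 0))) := by
    intro i j
    simp only [H, Matrix.of_apply, arbTangent, infoForm_apply, derivative_eq_steerDeriv_add,
      reInner_outer, reInner_add_left, reInner_smul_left]
    have e2 := h2 i j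
    have e3 := h3 i j
    rw [show reInner (Complex.I • steer M (φ i + δ * μ i) (μ i)) (r j) = 0 from e2,
      show reInner (steerDeriv M (φ i + δ * μ i) (μ i)) (r j) = _ from e3, hS]
    fin_cases i <;> fin_cases j <;> simp [projPow, projCross, hσ.ne'] <;> ring
  obtain ⟨hdet, htr⟩ := trace_inv_of_two (by positivity) hn hne hH
  rw [← htr, crb]
  congr 1
  refine inv_toBlocks₁₁_of_gram (infoForm _ σ2) (infoForm_definite hσ) (arbTangent M δ μ S₀ φ) _
    (fisherInfo_arb M δ μ S₀ φ hσ) (linearIndependent_arbTangent δ hc)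
    (fun i => (outer (r i) (S₀ i), 0)) ?_ ?_ H (fun i j => rfl) hdet
  · intro i
    set U := Submodule.span ℝ (Set.range fun j => arbTangent M δ μ S₀ φ (Sum.inr j))
    have hbase : ∀ l t (z : ℂ),
        ((outer (z • steer M (δ * μ l) (μ l)) (Pi.single t 1), 0) :
          (Fin M × Fin N → ℂ) × ℝ) ∈ U := by
      intro l t z
      have e1 : arbTangent M δ μ S₀ φ (Sum.inr (Sum.inl (l, t))) ∈ U :=
        Submodule.subset_span ⟨Sum.inl (l, t), rfl⟩
      have e2 : arbTangent M δ μ S₀ φ (Sum.inr (Sum.inr (Sum.inl (l, t)))) ∈ U :=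
        Submodule.subset_span ⟨Sum.inr (Sum.inl (l, t)), rfl⟩
      convert U.add_mem (U.smul_mem z.re e1) (U.smul_mem z.im e2) using 1
      rw [ofReal_re_smul_add_im_smul, outer_add_left, outer_smul_left, outer_smul_left]
      simp [arbTangent]
    have hspan : ∀ l (z : ℂ) (f : Fin N → ℝ),
        ((outer (z • a l) f, 0) : (Fin M × Fin N → ℂ) × ℝ) ∈ U := by
      intro l z f
      have : ((outer (z • a l) f, 0) : (Fin M × Fin N → ℂ) × ℝ) = ∑ t, f t •
          ((outer ((z * Complex.exp (Complex.I * (φ l : ℂ))) • steer M (δ * μ l) (μ l))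
            (Pi.single t 1), 0) : (Fin M × Fin N → ℂ) × ℝ) := by
        ext1
        · simp only [a, steer_add_phase, smul_smul, Prod.fst_sum, Prod.smul_fst]
          exact outer_eq_sum_single _ _
        · simp [Prod.snd_sum]
      rw [this]
      exact U.sum_mem fun t _ => U.smul_mem _ (hbase l t _)
    have hdiff : arbTangent M δ μ S₀ φ (Sum.inl i) - (outer (r i) (S₀ i), 0) =
        (outer (((δ : ℂ) * Complex.I) • a i) (S₀ i), 0) +
          ((outer (((x i 0 : ℂ) + (y i 0) * Complex.I) • a 0) (S₀ i), 0) +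
          (outer (((x i 1 : ℂ) + (y i 1) * Complex.I) • a 1) (S₀ i), 0)) := by
      ext1
      · simp only [arbTangent, derivative_eq_steerDeriv_add, Prod.fst_sub, Prod.fst_add,
          ← outer_sub_left, ← outer_add_left]
        congr 1
        ext m
        simp only [r, residual, a, w, Pi.add_apply, Pi.sub_apply, Pi.smul_apply, smul_eq_mul,
          Complex.real_smul]
        ring
      · simp [arbTangent]
    rw [hdiff]
    exact U.add_mem (hspan _ _ _) (U.add_mem (hspan _ _ _) (hspan _ _ _))
  · have horth : ∀ l i (z : ℂ), reInner (z • steer M (δ * μ l) (μ l)) (r i) = 0 := by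
      intro l i z
      have : z • steer M (δ * μ l) (μ l) = (z * Complex.exp (Complex.I * ((-φ l : ℝ) : ℂ))) • a l := by
        rw [mul_smul, show a l = steer M (φ l + δ * μ l) (μ l) from rfl, ← steer_add_phase,
          neg_add_cancel_left]
      rw [this, ofReal_re_smul_add_im_smul, reInner_add_left, reInner_smul_left,
        reInner_smul_left, h1, h2]
      ring
    rintro i (⟨l, t⟩ | ⟨l, t⟩ | u)
    · have := horth l i 1
      rw [one_smul] at this
      simp [infoForm_apply, arbTangent, reInner_outer, this]
    · simp [infoForm_apply, arbTangent, reInner_outer, horth]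
    · simp [infoForm_apply, arbTangent, reInner_zero_left]

/-- The gain in information about the frequencies from strict non-circularity, up to scaling. -/
def ncTerm (M : ℕ) (x ρ ψ : ℝ) : ℝ :=
  sinSum M x ^ 2 * Real.sin ψ ^ 2 * (1 - ρ ^ 2) * (M : ℝ) ^ 2 / ((M : ℝ) ^ 2 - cosSum M x ^ 2)

/-- The diagonal entry of the normalised information matrix of strictly non-circular sources. -/
def ncDiag (M : ℕ) (x ρ ψ : ℝ) : ℝ :=
  projPow M x + ncTerm M x ρ ψ * (M / ((M : ℝ) ^ 2 - ρ ^ 2 * cosSum M x ^ 2 * Real.cos ψ ^ 2))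

/-- The off-diagonal entry of the normalised information matrix of strictly non-circular
sources. -/
def ncOffDiag (M : ℕ) (x ρ ψ : ℝ) : ℝ :=
  ρ * projCross M x * Real.cos ψ - ncTerm M x ρ ψ *
    (ρ * cosSum M x * Real.cos ψ / ((M : ℝ) ^ 2 - ρ ^ 2 * cosSum M x ^ 2 * Real.cos ψ ^ 2))

theorem trace_ncCrb (hM : 0 < M) (hN : 0 < N) (hσ : 0 < σ2) (hρ : ρ ^ 2 ≤ 1)
    (hS0 : ∀ i, S₀ i ≠ 0)
    (hc : cosSum M (μ 1 - μ 0) ^ 2 < (M : ℝ) ^ 2) (hn : ∀ i, n i ≠ 0)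
    (hS : ∀ i j, S₀ i ⬝ᵥ S₀ j = n i * n j * !![1, ρ; ρ, 1] i j)
    (hne : ncDiag M (μ 1 - μ 0) ρ ((φ 1 + δ * μ 1) - (φ 0 + δ * μ 0)) ^ 2 -
      ncOffDiag M (μ 1 - μ 0) ρ ((φ 1 + δ * μ 1) - (φ 0 + δ * μ 0)) ^ 2 ≠ 0) :
    (ncCrb M δ μ S₀ φ σ2).trace = 1 / (2 / σ2) * (1 / n 0 ^ 2 + 1 / n 1 ^ 2) *
      (ncDiag M (μ 1 - μ 0) ρ ((φ 1 + δ * μ 1) - (φ 0 + δ * μ 0)) /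
        (ncDiag M (μ 1 - μ 0) ρ ((φ 1 + δ * μ 1) - (φ 0 + δ * μ 0)) ^ 2 -
          ncOffDiag M (μ 1 - μ 0) ρ ((φ 1 + δ * μ 1) - (φ 0 + δ * μ 0)) ^ 2)) := by
  have : Nonempty (Fin M × Fin N) := ⟨(⟨0, hM⟩, ⟨0, hN⟩)⟩
  have hG := steeringGram M (fun l => φ l + δ * μ l) μ
  obtain ⟨x, x', y, h1, h1', h2, h3⟩ := hG.exists_residual_nc hc hρ
  set a : Fin 2 → Fin M → ℂ := fun i => steer M (φ i + δ * μ i) (μ i)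
  set w : Fin 2 → Fin M → ℂ := fun i => steerDeriv M (φ i + δ * μ i) (μ i)
  let v : Fin 2 → Fin M → ℂ := fun i => residual a (w i) (x i) 0
  let u : Fin 2 → Fin M → ℂ := fun i => residual a (Complex.I • a i) (x' i) 0
  -- The coefficients `y` belong to normalised signals; the ratio n_i/n_l converts them to the
  -- actual ones.
  let r : Fin 2 → Fin M × Fin N → ℂ := fun i => outer (v i) (S₀ i) -
    ((y 0 i * (n i / n 0)) • outer (u 0) (S₀ 0) + (y 1 i * (n i / n 1)) • outer (u 1) (S₀ 1))
  have hr : ∀ (b : Fin M → ℂ) (f : Fin N → ℝ) i, reInner (outer b f) (r i) =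
      reInner b (v i) * (f ⬝ᵥ S₀ i) - (y 0 i * (n i / n 0) * (reInner b (u 0) * (f ⬝ᵥ S₀ 0)) +
        y 1 i * (n i / n 1) * (reInner b (u 1) * (f ⬝ᵥ S₀ 1))) := by
    intro b f i
    simp only [r, reInner_sub_right, reInner_add_right, reInner_smul_right, reInner_outer]
  have n0 := hn 0
  have n1 := hn 1
  have horthu : ∀ l i, reInner (outer (Complex.I • a l) (S₀ l)) (r i) = 0 := by
    intro l i
    have e2 := h2 l i
    rw [Fin.sum_univ_two] at e2
    rw [hr, hS, hS, hS]
    change !![1, ρ; ρ, 1] l i * reInner (Complex.I • a l) (v i) =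
      y 0 i * (!![1, ρ; ρ, 1] l 0 * reInner (Complex.I • a l) (u 0)) +
      y 1 i * (!![1, ρ; ρ, 1] l 1 * reInner (Complex.I • a l) (u 1)) at e2
    field_simp
    linear_combination (n l * n i) * e2
  let H : Matrix (Fin 2) (Fin 2) ℝ := Matrix.of fun i j =>
    infoForm _ σ2 (ncTangent M δ μ S₀ φ (Sum.inl i)) (r j, 0)
  have hH : ∀ i j, H i j = 2 / σ2 * (n i * n j *
      if i = j then ncDiag M (μ 1 - μ 0) ρ ((φ 1 + δ * μ 1) - (φ 0 + δ * μ 0))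
      else ncOffDiag M (μ 1 - μ 0) ρ ((φ 1 + δ * μ 1) - (φ 0 + δ * μ 0))) := by
    intro i j
    simp only [H, Matrix.of_apply, ncTangent, infoForm_apply, derivative_eq_steerDeriv_add,
      outer_add_left, outer_smul_left, reInner_add_left, reInner_smul_left]
    rw [show reInner (outer (Complex.I • steer M (φ i + δ * μ i) (μ i)) (S₀ i)) (r j) = 0 from
      horthu i j, show outer (steerDeriv M (φ i + δ * μ i) (μ i)) (S₀ i) = outer (w i) (S₀ i)
      from rfl, hr, hS, hS, hS, ncDiag, ncOffDiag, ncTerm]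
    have e3 := h3 i j
    rw [Fin.sum_univ_two] at e3
    change !![1, ρ; ρ, 1] i j * reInner (w i) (v j) -
      (y 0 j * (!![1, ρ; ρ, 1] i 0 * reInner (w i) (u 0)) +
      y 1 j * (!![1, ρ; ρ, 1] i 1 * reInner (w i) (u 1))) = _ at e3
    have q0 : n j / n 0 * n 0 = n j := div_mul_cancel₀ _ n0
    have q1 : n j / n 1 * n 1 = n j := div_mul_cancel₀ _ n1
    rw [projPow, projCross]
    split_ifs at e3 ⊢ <;>
    linear_combination (2 / σ2 * (n i * n j)) * e3 -
      (2 / σ2 * y 0 j * reInner (w i) (u 0) * n i * !![1, ρ; ρ, 1] i 0) * q0 -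
      (2 / σ2 * y 1 j * reInner (w i) (u 1) * n i * !![1, ρ; ρ, 1] i 1) * q1
  obtain ⟨hdet, htr⟩ := trace_inv_of_two (by positivity) hn hne hH
  rw [← htr, ncCrb]
  congr 1
  refine inv_toBlocks₁₁_of_gram (infoForm _ σ2) (infoForm_definite hσ) (ncTangent M δ μ S₀ φ) _
    (fisherInfo_nc M δ μ S₀ φ hσ) (linearIndependent_ncTangent δ hc hS0)
    (fun i => (r i, 0)) ?_ ?_ H (fun i j => rfl) hdet
  · intro i
    set U := Submodule.span ℝ (Set.range fun j => ncTangent M δ μ S₀ φ (Sum.inr j))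
    have hspan : ∀ l (f : Fin N → ℝ),
        ((outer (a l) f, 0) : (Fin M × Fin N → ℂ) × ℝ) ∈ U := by
      intro l f
      have : ((outer (a l) f, 0) : (Fin M × Fin N → ℂ) × ℝ) = ∑ t, f t •
          ncTangent M δ μ S₀ φ (Sum.inr (Sum.inl (l, t))) := by
        ext1
        · simp only [Prod.fst_sum, Prod.smul_fst, ncTangent]
          exact outer_eq_sum_single _ _
        · simp [Prod.snd_sum, ncTangent]
      rw [this]
      exact U.sum_mem fun t _ => U.smul_mem _ (Submodule.subset_span ⟨Sum.inl (l, t), rfl⟩)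
    have hspan' : ∀ l, ((outer (Complex.I • a l) (S₀ l), 0) : (Fin M × Fin N → ℂ) × ℝ) ∈ U :=
      fun l => Submodule.subset_span ⟨Sum.inr (Sum.inl l), rfl⟩
    have hu : ∀ l, ((outer (u l) (S₀ l), 0) : (Fin M × Fin N → ℂ) × ℝ) ∈ U := by
      intro l
      have : ((outer (u l) (S₀ l), 0) : (Fin M × Fin N → ℂ) × ℝ) =
          (outer (Complex.I • a l) (S₀ l), 0) - (x' l 0 • (outer (a 0) (S₀ l), 0) +
            x' l 1 • (outer (a 1) (S₀ l), 0)) := by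
        simp [u, residual, outer_sub_left, outer_add_left, outer_smul_left]
      rw [this]
      exact U.sub_mem (hspan' l) (U.add_mem (U.smul_mem _ (hspan _ _)) (U.smul_mem _ (hspan _ _)))
    have hdiff : ncTangent M δ μ S₀ φ (Sum.inl i) - (r i, 0) =
        δ • (outer (Complex.I • a i) (S₀ i), 0) +
          ((x i 0 • (outer (a 0) (S₀ i), 0) + x i 1 • (outer (a 1) (S₀ i), 0)) +
          ((y 0 i * (n i / n 0)) • (outer (u 0) (S₀ 0), 0) +
            (y 1 i * (n i / n 1)) • (outer (u 1) (S₀ 1), 0))) := by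
      ext1
      · simp only [ncTangent, derivative_eq_steerDeriv_add, Prod.fst_sub, Prod.fst_add, r, v,
          residual, outer_sub_left, outer_add_left, outer_smul_left, Prod.smul_fst]
        simp only [a, w, Pi.zero_apply, zero_smul, add_zero]
        abel
      · simp [ncTangent]
    rw [hdiff]
    exact U.add_mem (U.smul_mem _ (hspan' _)) (U.add_mem (U.add_mem (U.smul_mem _ (hspan _ _))
      (U.smul_mem _ (hspan _ _))) (U.add_mem (U.smul_mem _ (hu _)) (U.smul_mem _ (hu _))))
  · rintro i (⟨l, t⟩ | l | u')
    · have : reInner (outer (a l) (Pi.single t 1)) (r i) = 0 := by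
        rw [hr, h1, h1', h1']; ring
      simp only [infoForm_apply, ncTangent]
      rw [show reInner (outer (steer M (φ l + δ * μ l) (μ l)) (Pi.single t 1)) (r i) = 0 from this]
      simp
    · simp only [infoForm_apply, ncTangent]
      rw [show reInner (outer (Complex.I • steer M (φ l + δ * μ l) (μ l)) (S₀ l)) (r i) = 0 from
        horthu l i]
      simp
    · simp [infoForm_apply, ncTangent, reInner_zero_left]

end trace


/-! ### Leading terms with relative error of second order -/

/-- `f x = a x ^ n + O (x ^ (n + 2))` as `x` tends to `0` from the right. -/
def LeadingTerm (f : ℝ → ℝ) (a : ℝ) (n : ℕ) : Prop :=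
  (fun x => f x - a * x ^ n) =O[nhdsWithin 0 (Set.Ioi 0)] fun x => x ^ (n + 2)

namespace LeadingTerm

open Asymptotics Filter

variable {f g : ℝ → ℝ} {a b : ℝ} {n m : ℕ}

theorem pow_isBigO_pow (h : n ≤ m) :
    (fun x : ℝ => x ^ m) =O[nhdsWithin 0 (Set.Ioi 0)] fun x => x ^ n :=
  IsBigO.of_bound 1 <| by
    filter_upwards [self_mem_nhdsWithin, mem_nhdsWithin_of_mem_nhds (Iio_mem_nhds one_pos)]
      with x hx hx1
    have hx0 : (0 : ℝ) < x := hx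
    rw [Real.norm_of_nonneg (by positivity), Real.norm_of_nonneg (by positivity), one_mul]
    exact pow_le_pow_of_le_one hx0.le hx1.le h

theorem congr' (h : LeadingTerm f a n) (hfg : ∀ᶠ x in nhdsWithin 0 (Set.Ioi 0), f x = g x) :
    LeadingTerm g a n := by
  refine IsBigO.congr' h ?_ EventuallyEq.rfl
  filter_upwards [hfg] with x hx using by rw [hx]

theorem coeff (h : LeadingTerm f a n) (hab : a = b) : LeadingTerm f b n := hab ▸ h

theorem monomial (a : ℝ) (n : ℕ) : LeadingTerm (fun x => a * x ^ n) a n := by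
  simpa [LeadingTerm] using isBigO_zero _ _

theorem const (a : ℝ) : LeadingTerm (fun _ => a) a 0 := by
  simpa [LeadingTerm] using isBigO_zero _ _

theorem add (hf : LeadingTerm f a n) (hg : LeadingTerm g b n) :
    LeadingTerm (fun x => f x + g x) (a + b) n :=
  (IsBigO.add hf hg).congr_left fun x => by ring

theorem const_mul (c : ℝ) (hf : LeadingTerm f a n) : LeadingTerm (fun x => c * f x) (c * a) n :=
  (IsBigO.const_mul_left hf c).congr_left fun x => by ring

theorem sub (hf : LeadingTerm f a n) (hg : LeadingTerm g b n) :
    LeadingTerm (fun x => f x - g x) (a - b) n :=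
  (IsBigO.sub hf hg).congr_left fun x => by ring

theorem sum {ι : Type*} (s : Finset ι) {F : ι → ℝ → ℝ} {A : ι → ℝ}
    (h : ∀ i ∈ s, LeadingTerm (F i) (A i) n) :
    LeadingTerm (fun x => ∑ i ∈ s, F i x) (∑ i ∈ s, A i) n :=
  (IsBigO.sum h).congr_left fun x => by simp [Finset.sum_sub_distrib, Finset.sum_mul]

theorem isBigO (h : LeadingTerm f a n) :
    f =O[nhdsWithin 0 (Set.Ioi 0)] fun x => x ^ n :=
  ((IsBigO.trans h (pow_isBigO_pow (by omega))).add
    ((isBigO_refl (fun x : ℝ => x ^ n) _).const_mul_left a)).congr_left fun x => by ring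

/-- A term two orders smaller is absorbed by the error, so it can be added to a lower-order
expansion with coefficient 0. -/
theorem lower (h : LeadingTerm f a (n + 2)) : LeadingTerm f 0 n :=
  h.isBigO.congr_left fun x => by ring

theorem mul (hf : LeadingTerm f a n) (hg : LeadingTerm g b m) :
    LeadingTerm (fun x => f x * g x) (a * b) (n + m) := by
  have h1 := (IsBigO.mul hf hg.isBigO).congr_right fun x => show _ = x ^ (n + m + 2) by ring
  have h2 := (((isBigO_refl (fun x : ℝ => x ^ n) (nhdsWithin 0 (Set.Ioi 0))).const_mul_left a).mul
    hg).congr_right fun x => show _ = x ^ (n + m + 2) by ring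
  exact (h1.add h2).congr_left fun x => by ring

theorem pow_two (hf : LeadingTerm f a n) :
    LeadingTerm (fun x => f x ^ 2) (a ^ 2) (n + n) := by
  simpa only [sq] using hf.mul hf

theorem eventually_pos (hg : LeadingTerm g b m) (hb : 0 < b) :
    ∀ᶠ x in nhdsWithin 0 (Set.Ioi 0), b / 2 * x ^ m ≤ g x := by
  obtain ⟨K, hK⟩ := (isBigO_iff.1 hg)
  have ht : ∀ᶠ x in nhdsWithin (0 : ℝ) (Set.Ioi 0), K * x ^ 2 < b / 2 := by
    have : Tendsto (fun x : ℝ => K * x ^ 2) (nhds 0) (nhds (K * 0 ^ 2)) :=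
      (by fun_prop : Continuous fun x : ℝ => K * x ^ 2).tendsto 0
    exact mem_nhdsWithin_of_mem_nhds (this (Iio_mem_nhds (by simpa using half_pos hb)))
  filter_upwards [hK, ht, self_mem_nhdsWithin] with x h1 h2 hx
  have hx' : 0 < x ^ m := pow_pos hx m
  rw [Real.norm_eq_abs, Real.norm_of_nonneg (pow_pos hx _).le, pow_add] at h1
  have := (abs_le.1 h1).1
  nlinarith

/-- The error is (f - (a/b)xⁿg)/g, where the numerator is O(xⁿ⁺ᵐ⁺²) and g ≥ (b/2)xᵐ near 0. The
coefficient `a` may vanish. -/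
theorem div (hf : LeadingTerm f a (n + m)) (hg : LeadingTerm g b m) (hb : 0 < b) :
    LeadingTerm (fun x => f x / g x) (a / b) n := by
  have h1 : (fun x => f x - a / b * x ^ n * g x) =O[nhdsWithin 0 (Set.Ioi 0)]
      fun x => x ^ (n + m + 2) := by
    have h2 := (((isBigO_refl (fun x : ℝ => x ^ n) (nhdsWithin 0 (Set.Ioi 0))).const_mul_left
      (a / b)).mul hg).congr_right fun x => show _ = x ^ (n + m + 2) by ring
    exact (IsBigO.sub hf h2).congr_left fun x => by field_simp; ring
  obtain ⟨K, hK⟩ := isBigO_iff.1 h1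
  refine IsBigO.of_bound (K * (2 / b)) ?_
  filter_upwards [hK, hg.eventually_pos hb, self_mem_nhdsWithin] with x h1 h2 hx
  have hx' : 0 < x ^ m := pow_pos hx m
  have hg0 : 0 < g x := lt_of_lt_of_le (by positivity) h2
  rw [show f x / g x - a / b * x ^ n = (f x - a / b * x ^ n * g x) / g x by field_simp]
  rw [norm_div, Real.norm_of_nonneg hg0.le, div_le_iff₀ hg0]
  rw [Real.norm_of_nonneg (pow_pos hx _).le] at h1 ⊢
  have hK0 : 0 ≤ K * x ^ (n + m + 2) := (norm_nonneg _).trans h1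
  have hK1 : 0 ≤ K := nonneg_of_mul_nonneg_left hK0 (pow_pos hx _)
  have hxn : 0 < x ^ (n + 2) := pow_pos hx _
  calc _ ≤ K * x ^ (n + m + 2) := h1
    _ = K * (2 / b) * x ^ (n + 2) * (b / 2 * x ^ m) := by field_simp; ring
    _ ≤ _ := by gcongr

theorem exists_bound (h : LeadingTerm f 0 0) :
    ∃ K, ∀ᶠ x in nhdsWithin 0 (Set.Ioi 0), |f x| ≤ K * x ^ 2 := by
  obtain ⟨K, hK⟩ := isBigO_iff.1 h
  refine ⟨K, ?_⟩
  filter_upwards [hK] with x hx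
  simpa using hx

theorem abs_sin_sub_le {y : ℝ} (hy : |y| ≤ 1) : |Real.sin y - (y - y ^ 3 / 6)| ≤ |y| ^ 5 := by
  have hz : ‖(y : ℂ) * Complex.I‖ = |y| := by simp
  -- Five terms of the exponential series at jy: the fourth power is real, so the imaginary part is
  -- y - y³/6 with an error of order five, two above the cubic term.
  have h := Complex.exp_bound (x := (y : ℂ) * Complex.I) (by rw [hz]; exact hy) (n := 5)
    (by norm_num)
  rw [hz] at h
  have h2 := (Complex.abs_im_le_norm _).trans h
  have h3 : (Complex.exp ((y : ℂ) * Complex.I) - ∑ m ∈ Finset.range 5,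
      ((y : ℂ) * Complex.I) ^ m / (m.factorial : ℂ)).im = Real.sin y - (y - y ^ 3 / 6) := by
    have hI3 : Complex.I ^ 3 = -Complex.I := Complex.I_pow_three
    have hs : ∑ m ∈ Finset.range 5, ((y : ℂ) * Complex.I) ^ m / (m.factorial : ℂ) =
        ((1 - y ^ 2 / 2 + y ^ 4 / 24 : ℝ) : ℂ) + ((y - y ^ 3 / 6 : ℝ) : ℂ) * Complex.I := by
      simp only [Finset.sum_range_succ, Finset.range_zero, Finset.sum_empty, mul_pow, hI3,
        Complex.I_sq, Complex.I_pow_four, Nat.factorial]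
      push_cast
      ring
    rw [hs, Complex.sub_im, Complex.exp_ofReal_mul_I_im, Complex.add_im, Complex.ofReal_im,
      Complex.im_ofReal_mul, Complex.I_im]
    ring
  rw [h3] at h2
  refine h2.trans ?_
  have : (0 : ℝ) ≤ |y| ^ 5 := by positivity
  norm_num [Nat.factorial]
  nlinarith

theorem sin_sub_self (a : ℝ) :
    LeadingTerm (fun x => Real.sin (a * x) - a * x) (-(a ^ 3 / 6)) 3 := by
  refine IsBigO.of_bound (|a| ^ 5) ?_
  have ht : Tendsto (fun x : ℝ => |a * x|) (nhds 0) (nhds |a * 0|) :=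
    (by fun_prop : Continuous fun x : ℝ => |a * x|).tendsto 0
  rw [mul_zero, abs_zero] at ht
  filter_upwards [mem_nhdsWithin_of_mem_nhds (ht (Iio_mem_nhds one_pos)), self_mem_nhdsWithin]
    with x hx hx0
  have hx0' : (0 : ℝ) < x := hx0
  have := abs_sin_sub_le (le_of_lt hx)
  rw [Real.norm_eq_abs, Real.norm_of_nonneg (by positivity)]
  rw [abs_mul a, mul_pow |a|, abs_of_pos hx0'] at this
  refine le_trans (le_of_eq ?_) (this.trans (le_of_eq ?_))
  · congr 1; ring
  · ring

theorem sin_mul (a : ℝ) : LeadingTerm (fun x => Real.sin (a * x)) a 1 := by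
  have := (sin_sub_self a).lower.add (monomial a 1)
  simpa using this

end LeadingTerm


/-! ### The projected powers as Lagrange sums -/

/-- Lagrange's identity. It turns differences that nearly cancel into sums of squares, from which
sign and order of vanishing can be read. -/
theorem sum_sum_minor_sq {ι : Type*} [Fintype ι] (x y : ι → ℝ) :
    ∑ k, ∑ l, (x k * y l - x l * y k) ^ 2 =
      2 * ((∑ k, x k ^ 2) * (∑ k, y k ^ 2) - (∑ k, x k * y k) ^ 2) := by
  have h : ∀ k l, (x k * y l - x l * y k) ^ 2 =
      x k ^ 2 * y l ^ 2 + y k ^ 2 * x l ^ 2 - 2 * ((x k * y k) * (x l * y l)) := by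
    intro k l; ring
  simp only [h, Finset.sum_sub_distrib, Finset.sum_add_distrib, ← Finset.mul_sum,
    ← Finset.sum_mul]
  ring

section sums

variable (M : ℕ) (x : ℝ)

/-- Half angles, here and in the next lemmas, exhibit M ∓ c, p ± q and s as squared norms and inner
products of the vectors to which Lagrange's identity is applied. -/
theorem sub_cosSum : (M : ℝ) - cosSum M x = 2 * ∑ m, Real.sin (arrayPos M m * (x / 2)) ^ 2 := by
  have h : ∀ m, Real.cos (arrayPos M m * x) = 1 - 2 * Real.sin (arrayPos M m * (x / 2)) ^ 2 := by
    intro m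
    rw [show arrayPos M m * x = 2 * (arrayPos M m * (x / 2)) by ring, Real.cos_two_mul,
      Real.cos_sq']
    ring
  simp only [cosSum, h, Finset.sum_sub_distrib, ← Finset.mul_sum]
  simp

theorem add_cosSum : (M : ℝ) + cosSum M x = 2 * ∑ m, Real.cos (arrayPos M m * (x / 2)) ^ 2 := by
  have h : ∀ m, Real.cos (arrayPos M m * x) = 2 * Real.cos (arrayPos M m * (x / 2)) ^ 2 - 1 := by
    intro m
    rw [show arrayPos M m * x = 2 * (arrayPos M m * (x / 2)) by ring, Real.cos_two_mul]
  simp only [cosSum, h, Finset.sum_sub_distrib, ← Finset.mul_sum]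
  simp

theorem sqSum_sub_sqCosSum : sqSum M - sqCosSum M x =
    2 * ∑ m, (arrayPos M m * Real.sin (arrayPos M m * (x / 2))) ^ 2 := by
  simp only [sqSum, sqCosSum, ← Finset.sum_sub_distrib, Finset.mul_sum]
  refine Finset.sum_congr rfl fun m _ => ?_
  rw [show arrayPos M m * x = 2 * (arrayPos M m * (x / 2)) by ring, Real.cos_two_mul,
    Real.cos_sq']
  ring

theorem sqSum_add_sqCosSum : sqSum M + sqCosSum M x =
    2 * ∑ m, (arrayPos M m * Real.cos (arrayPos M m * (x / 2))) ^ 2 := by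
  simp only [sqSum, sqCosSum, ← Finset.sum_add_distrib, Finset.mul_sum]
  refine Finset.sum_congr rfl fun m _ => ?_
  rw [show arrayPos M m * x = 2 * (arrayPos M m * (x / 2)) by ring, Real.cos_two_mul]
  ring

theorem sinSum_eq : sinSum M x = 2 * ∑ m, arrayPos M m * Real.cos (arrayPos M m * (x / 2)) *
    Real.sin (arrayPos M m * (x / 2)) := by
  simp only [sinSum, Finset.mul_sum]
  refine Finset.sum_congr rfl fun m _ => ?_
  rw [show arrayPos M m * x = 2 * (arrayPos M m * (x / 2)) by ring, Real.sin_two_mul]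
  ring

/-- The `2 × 2` minors of the vectors `k cos (k x / 2)` and `sin (k x / 2)`. -/
def evenMinor (k l : Fin M) : ℝ :=
  arrayPos M k * Real.cos (arrayPos M k * (x / 2)) * Real.sin (arrayPos M l * (x / 2)) -
    arrayPos M l * Real.cos (arrayPos M l * (x / 2)) * Real.sin (arrayPos M k * (x / 2))

/-- The `2 × 2` minors of the vectors `k sin (k x / 2)` and `cos (k x / 2)`. -/
def oddMinor (k l : Fin M) : ℝ :=
  arrayPos M k * Real.sin (arrayPos M k * (x / 2)) * Real.cos (arrayPos M l * (x / 2)) -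
    arrayPos M l * Real.sin (arrayPos M l * (x / 2)) * Real.cos (arrayPos M k * (x / 2))

theorem sum_evenMinor_sq : 2 * ∑ k, ∑ l, evenMinor M x k l ^ 2 =
    (sqSum M + sqCosSum M x) * (M - cosSum M x) - sinSum M x ^ 2 := by
  simp only [evenMinor]
  rw [sum_sum_minor_sq, sqSum_add_sqCosSum, sub_cosSum, sinSum_eq]
  ring

theorem sum_oddMinor_sq : 2 * ∑ k, ∑ l, oddMinor M x k l ^ 2 =
    (sqSum M - sqCosSum M x) * (M + cosSum M x) - sinSum M x ^ 2 := by
  simp only [oddMinor]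
  rw [sum_sum_minor_sq, sqSum_sub_sqCosSum, add_cosSum, sinSum_eq,
    show ∀ s : ℝ, (2 * s) ^ 2 = 4 * s ^ 2 from fun s => by ring]
  rw [show ∑ m, arrayPos M m * Real.sin (arrayPos M m * (x / 2)) *
      Real.cos (arrayPos M m * (x / 2)) = ∑ m, arrayPos M m * Real.cos (arrayPos M m * (x / 2)) *
      Real.sin (arrayPos M m * (x / 2)) from Finset.sum_congr rfl fun m _ => by ring]
  ring

variable {M x}

/-- As M² - c² = (M-c)(M+c), adding cancels M+c and leaves p + q - s²/(M-c), a Lagrange difference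
over M-c. Subtracting cancels the other factor. -/
theorem projPow_add_projCross (h1 : 0 < M - cosSum M x) (h2 : 0 < M + cosSum M x) :
    projPow M x + projCross M x =
      (2 * ∑ k, ∑ l, evenMinor M x k l ^ 2) / (M - cosSum M x) := by
  rw [sum_evenMinor_sq, projPow, projCross,
    show (M : ℝ) ^ 2 - cosSum M x ^ 2 = (M - cosSum M x) * (M + cosSum M x) by ring]
  field_simp
  ring

theorem projPow_sub_projCross (h1 : 0 < M - cosSum M x) (h2 : 0 < M + cosSum M x) :
    projPow M x - projCross M x =
      (2 * ∑ k, ∑ l, oddMinor M x k l ^ 2) / (M + cosSum M x) := by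
  rw [sum_oddMinor_sq, projPow, projCross,
    show (M : ℝ) ^ 2 - cosSum M x ^ 2 = (M - cosSum M x) * (M + cosSum M x) by ring]
  field_simp
  ring

/-! ### Strict positivity from explicit sensors -/

theorem exists_arrayPos_eq (M : ℕ) (j : ℕ) (hj : j < M) (r : ℝ)
    (hr : (j : ℝ) - ((M : ℝ) - 1) / 2 = r) :
    ∃ m, arrayPos M m = r := ⟨⟨j, hj⟩, hr⟩

/-- An array of `M ≥ 3` sensors has sensors at `0, 1` (and `2` if `M ≥ 4`), or at `1/2, 3/2`. -/
theorem exists_sensors (hM : 3 ≤ M) :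
    ((∃ m, arrayPos M m = 0) ∧ (∃ m, arrayPos M m = 1) ∧ (4 ≤ M → ∃ m, arrayPos M m = 2)) ∨
      ((∃ m, arrayPos M m = 1 / 2) ∧ ∃ m, arrayPos M m = 3 / 2) := by
  rcases Nat.even_or_odd' M with ⟨j, rfl | rfl⟩
  · right
    exact ⟨exists_arrayPos_eq _ j (by omega) _ (by push_cast; ring),
      exists_arrayPos_eq _ (j + 1) (by omega) _ (by push_cast; ring)⟩
  · left
    exact ⟨exists_arrayPos_eq _ j (by omega) _ (by push_cast; ring),
      exists_arrayPos_eq _ (j + 1) (by omega) _ (by push_cast; ring),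
      fun h => exists_arrayPos_eq _ (j + 2) (by omega) _ (by push_cast; ring)⟩

theorem sum_sq_pos_of_ne {ι : Type*} [Fintype ι] {f : ι → ℝ} (i : ι) (h : f i ≠ 0) :
    0 < ∑ i, f i ^ 2 :=
  Finset.sum_pos' (fun _ _ => sq_nonneg _) ⟨i, Finset.mem_univ i, by positivity⟩

theorem sum_sum_sq_pos_of_ne {ι : Type*} [Fintype ι] {f : ι → ι → ℝ} (i j : ι) (h : f i j ≠ 0) :
    0 < ∑ i, ∑ j, f i j ^ 2 :=
  Finset.sum_pos' (fun _ _ => Finset.sum_nonneg fun _ _ => sq_nonneg _)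
    ⟨i, Finset.mem_univ i, sum_sq_pos_of_ne j h⟩

theorem sin_half_pos (hx0 : 0 < x) (hx : x < 2 * Real.pi) : 0 < Real.sin (x / 2) :=
  Real.sin_pos_of_pos_of_lt_pi (by linarith) (by linarith)

theorem sin_quarter_pos (hx0 : 0 < x) (hx : x < 2 * Real.pi) : 0 < Real.sin (x / 4) :=
  Real.sin_pos_of_pos_of_lt_pi (by linarith) (by linarith)

theorem cos_quarter_pos (hx0 : 0 < x) (hx : x < 2 * Real.pi) : 0 < Real.cos (x / 4) :=
  Real.cos_pos_of_mem_Ioo ⟨by linarith, by linarith⟩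

theorem sub_cosSum_pos (hx0 : 0 < x) (hx : x < 2 * Real.pi) (hM : 3 ≤ M) : 0 < M - cosSum M x := by
  rw [sub_cosSum]
  refine mul_pos two_pos ?_
  rcases exists_sensors hM with ⟨_, ⟨m, hm⟩, _⟩ | ⟨⟨m, hm⟩, _⟩
  · refine sum_sq_pos_of_ne m ?_
    rw [hm, one_mul]
    exact (sin_half_pos hx0 hx).ne'
  · refine sum_sq_pos_of_ne m ?_
    rw [hm, show 1 / 2 * (x / 2) = x / 4 by ring]
    exact (sin_quarter_pos hx0 hx).ne'

theorem add_cosSum_pos (hx0 : 0 < x) (hx : x < 2 * Real.pi) (hM : 3 ≤ M) : 0 < M + cosSum M x := by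
  rw [add_cosSum]
  refine mul_pos two_pos ?_
  rcases exists_sensors hM with ⟨⟨m, hm⟩, _, _⟩ | ⟨⟨m, hm⟩, _⟩
  · refine sum_sq_pos_of_ne m ?_
    rw [hm, zero_mul, Real.cos_zero]
    exact one_ne_zero
  · refine sum_sq_pos_of_ne m ?_
    rw [hm, show 1 / 2 * (x / 2) = x / 4 by ring]
    exact (cos_quarter_pos hx0 hx).ne'

/-- A single nonzero minor suffices. For the sensors 0, 1 it is sin(x/2), for 1/2, 3/2 it is -4
sin(x/4) cos³(x/4); neither vanishes for 0 < x < 2π. -/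
theorem projCross_lt_projPow (hx0 : 0 < x) (hx : x < 2 * Real.pi) (hM : 3 ≤ M) :
    0 < projPow M x - projCross M x := by
  rw [projPow_sub_projCross (sub_cosSum_pos hx0 hx hM) (add_cosSum_pos hx0 hx hM)]
  refine div_pos (mul_pos two_pos ?_) (add_cosSum_pos hx0 hx hM)
  rcases exists_sensors hM with ⟨⟨m, hm⟩, ⟨m', hm'⟩, _⟩ | ⟨⟨m, hm⟩, ⟨m', hm'⟩⟩
  · refine sum_sum_sq_pos_of_ne m' m ?_
    have := (sin_half_pos hx0 hx).ne'
    simpa [oddMinor, hm, hm'] using this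
  · refine sum_sum_sq_pos_of_ne m m' ?_
    have hs := (sin_quarter_pos hx0 hx).ne'
    have hc := (cos_quarter_pos hx0 hx).ne'
    have : oddMinor M x m m' = -4 * Real.sin (x / 4) * Real.cos (x / 4) ^ 3 := by
      rw [oddMinor, hm, hm', show 1 / 2 * (x / 2) = x / 4 by ring,
        show 3 / 2 * (x / 2) = 3 * (x / 4) by ring, Real.sin_three_mul, Real.cos_three_mul]
      linear_combination 6 * Real.sin (x / 4) * Real.cos (x / 4) *
        Real.sin_sq_add_cos_sq (x / 4)
    rw [this]
    positivity

theorem neg_projCross_le_projPow (hx0 : 0 < x) (hx : x < 2 * Real.pi) (hM : 3 ≤ M) :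
    0 ≤ projPow M x + projCross M x := by
  rw [projPow_add_projCross (sub_cosSum_pos hx0 hx hM) (add_cosSum_pos hx0 hx hM)]
  exact div_nonneg (mul_nonneg two_pos.le (Finset.sum_nonneg fun _ _ =>
    Finset.sum_nonneg fun _ _ => sq_nonneg _)) (sub_cosSum_pos hx0 hx hM).le

/-- The minor for the sensors 1, 2 is 2 sin³(x/2); with only three elements no sensor at 2 exists.
-/
theorem neg_projCross_lt_projPow (hx0 : 0 < x) (hx : x < 2 * Real.pi) (hM : 4 ≤ M) :
    0 < projPow M x + projCross M x := by
  have hM3 : 3 ≤ M := by omega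
  rw [projPow_add_projCross (sub_cosSum_pos hx0 hx hM3) (add_cosSum_pos hx0 hx hM3)]
  refine div_pos (mul_pos two_pos ?_) (sub_cosSum_pos hx0 hx hM3)
  rcases exists_sensors hM3 with ⟨_, ⟨m, hm⟩, h2⟩ | ⟨⟨m, hm⟩, ⟨m', hm'⟩⟩
  · obtain ⟨m', hm'⟩ := h2 hM
    refine sum_sum_sq_pos_of_ne m m' ?_
    have hs := (sin_half_pos hx0 hx).ne'
    have : evenMinor M x m m' = 2 * Real.sin (x / 2) ^ 3 := by
      simp only [evenMinor, hm, hm', one_mul]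
      rw [Real.sin_two_mul, Real.cos_two_mul]
      linear_combination -2 * Real.sin (x / 2) * Real.sin_sq_add_cos_sq (x / 2)
    rw [this]
    positivity
  · refine sum_sum_sq_pos_of_ne m m' ?_
    have hs := (sin_quarter_pos hx0 hx).ne'
    have hc := (cos_quarter_pos hx0 hx).ne'
    have : evenMinor M x m m' = 4 * Real.sin (x / 4) ^ 3 * Real.cos (x / 4) := by
      rw [evenMinor, hm, hm', show 1 / 2 * (x / 2) = x / 4 by ring,
        show 3 / 2 * (x / 2) = 3 * (x / 4) by ring, Real.sin_three_mul, Real.cos_three_mul]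
      linear_combination -6 * Real.sin (x / 4) * Real.cos (x / 4) *
        Real.sin_sq_add_cos_sq (x / 4)
    rw [this]
    positivity

theorem projPow_pos (hx0 : 0 < x) (hx : x < 2 * Real.pi) (hM : 3 ≤ M) :
    0 < projPow M x := by
  linarith [projCross_lt_projPow hx0 hx hM, neg_projCross_le_projPow hx0 hx hM]

/-- On the positions -1, 0, 1 the vectors k cos(kx/2) and sin(kx/2) are proportional. Hence β = -α
for three elements, which is why t² < 1 has to be assumed there. -/
theorem evenMinor_three (x : ℝ) (k l : Fin 3) : evenMinor 3 x k l = 0 := by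
  have h : ∀ m : Fin 3, arrayPos 3 m = -1 ∨ arrayPos 3 m = 0 ∨ arrayPos 3 m = 1 := by
    intro m; fin_cases m <;> norm_num [arrayPos]
  rcases h k with hk | hk | hk <;> rcases h l with hl | hl | hl <;> simp [evenMinor, hk, hl]

end sums

/-! ### Moments of the sensor positions -/

theorem sum_arrayPos (M : ℕ) (f : ℝ → ℝ) :
    ∑ m, f (arrayPos M m) = ∑ m ∈ Finset.range M, f (m - ((M : ℝ) - 1) / 2) :=
  Fin.sum_univ_eq_sum_range (fun m => f ((m : ℝ) - ((M : ℝ) - 1) / 2)) M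

/-- The centre `a` is independent of `n`, since the array centroid would move during the induction.
-/
theorem sum_range_sub_pow_two (n : ℕ) (a : ℝ) : ∑ m ∈ Finset.range n, ((m : ℝ) - a) ^ 2 =
    n * (n - 1) * (2 * n - 1) / 6 - a * (n * (n - 1)) + n * a ^ 2 := by
  induction n with
  | zero => simp
  | succ n ih => rw [Finset.sum_range_succ, ih]; push_cast; ring

theorem sum_range_sub_pow_four (n : ℕ) (a : ℝ) : ∑ m ∈ Finset.range n, ((m : ℝ) - a) ^ 4 =
    n * (n - 1) * (2 * n - 1) * (3 * n ^ 2 - 3 * n - 1) / 30 - a * (n * (n - 1)) ^ 2 +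
      a ^ 2 * (n * (n - 1) * (2 * n - 1)) - 2 * a ^ 3 * (n * (n - 1)) + n * a ^ 4 := by
  induction n with
  | zero => simp
  | succ n ih => rw [Finset.sum_range_succ, ih]; push_cast; ring

theorem sum_range_sub_pow_six (n : ℕ) (a : ℝ) : ∑ m ∈ Finset.range n, ((m : ℝ) - a) ^ 6 =
    n * (n - 1) * (2 * n - 1) * (3 * n ^ 4 - 6 * n ^ 3 + 3 * n + 1) / 42 -
      a * ((n * (n - 1)) ^ 2 * (2 * n ^ 2 - 2 * n - 1)) / 2 +
      a ^ 2 * (n * (n - 1) * (2 * n - 1) * (3 * n ^ 2 - 3 * n - 1)) / 2 -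
      5 * a ^ 3 * (n * (n - 1)) ^ 2 +
      5 * a ^ 4 * (n * (n - 1) * (2 * n - 1)) / 2 - 3 * a ^ 5 * (n * (n - 1)) + n * a ^ 6 := by
  induction n with
  | zero => simp
  | succ n ih => rw [Finset.sum_range_succ, ih]; push_cast; ring

theorem sqSum_eq (M : ℕ) : sqSum M = M * (M ^ 2 - 1) / 12 := by
  rw [sqSum, sum_arrayPos M (fun k => k ^ 2), sum_range_sub_pow_two]; ring

theorem sum_arrayPos_pow_four (M : ℕ) :
    ∑ m, arrayPos M m ^ 4 = (M : ℝ) * (M ^ 2 - 1) * (3 * M ^ 2 - 7) / 240 := by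
  rw [sum_arrayPos M (fun k => k ^ 4), sum_range_sub_pow_four]; ring

theorem sum_arrayPos_pow_six (M : ℕ) : ∑ m, arrayPos M m ^ 6 =
    (M : ℝ) * (M ^ 2 - 1) * (3 * M ^ 4 - 18 * M ^ 2 + 31) / 1344 := by
  rw [sum_arrayPos M (fun k => k ^ 6), sum_range_sub_pow_six]; ring


/-! ### Closely spaced sources -/

/-- The minor equals ½[(a-b) sin((a+b)x/2) - (a+b) sin((a-b)x/2)], whose linear terms cancel. The
coefficient is a multiple of a minor of k³ and k, so Lagrange's identity applies again to the sum of
squares. -/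
theorem leadingTerm_evenMinor (M : ℕ) (k l : Fin M) : LeadingTerm (fun x => evenMinor M x k l)
    (-(arrayPos M k ^ 3 * arrayPos M l - arrayPos M l ^ 3 * arrayPos M k) / 24) 3 := by
  set a := arrayPos M k with ha
  set b := arrayPos M l with hb
  have h := (((LeadingTerm.sin_sub_self ((a + b) / 2)).const_mul (a - b)).sub
    ((LeadingTerm.sin_sub_self ((a - b) / 2)).const_mul (a + b))).const_mul (1 / 2)
  refine (h.congr' (Filter.Eventually.of_forall fun x => ?_)).coeff (by ring)
  rw [evenMinor, ← ha, ← hb, show (a + b) / 2 * x = a * (x / 2) + b * (x / 2) by ring,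
    show (a - b) / 2 * x = a * (x / 2) - b * (x / 2) by ring, Real.sin_add, Real.sin_sub]
  ring

/-- The factors 1 display the coefficient as a minor of the vectors k² and 1. -/
theorem leadingTerm_oddMinor (M : ℕ) (k l : Fin M) : LeadingTerm (fun x => oddMinor M x k l)
    ((arrayPos M k ^ 2 * 1 - arrayPos M l ^ 2 * 1) / 2) 1 := by
  set a := arrayPos M k with ha
  set b := arrayPos M l with hb
  have h := (((LeadingTerm.sin_mul ((a + b) / 2)).const_mul (a - b)).add
    ((LeadingTerm.sin_mul ((a - b) / 2)).const_mul (a + b))).const_mul (1 / 2)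
  refine (h.congr' (Filter.Eventually.of_forall fun x => ?_)).coeff (by ring)
  rw [oddMinor, ← ha, ← hb, show (a + b) / 2 * x = a * (x / 2) + b * (x / 2) by ring,
    show (a - b) / 2 * x = a * (x / 2) - b * (x / 2) by ring, Real.sin_add, Real.sin_sub]
  ring

theorem leadingTerm_sub_cosSum (M : ℕ) :
    LeadingTerm (fun x => M - cosSum M x) (sqSum M / 2) 2 := by
  have h := (LeadingTerm.sum Finset.univ fun (m : Fin M) _ =>
    (LeadingTerm.sin_mul (arrayPos M m / 2)).pow_two).const_mul 2
  refine (h.congr' (Filter.Eventually.of_forall fun x => ?_)).coeff ?_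
  · rw [sub_cosSum]
    congr 1
    exact Finset.sum_congr rfl fun m _ => by congr 2; ring
  · rw [sqSum, Finset.mul_sum, Finset.sum_div]
    exact Finset.sum_congr rfl fun m _ => by ring

theorem leadingTerm_add_cosSum (M : ℕ) : LeadingTerm (fun x => M + cosSum M x) (2 * M) 0 := by
  refine (((LeadingTerm.const (2 * (M : ℝ))).sub (leadingTerm_sub_cosSum M).lower).congr'
    (Filter.Eventually.of_forall fun x => ?_)).coeff (by ring)
  ring

theorem eventually_mem_range :
    ∀ᶠ x in nhdsWithin (0 : ℝ) (Set.Ioi 0), 0 < x ∧ x < 2 * Real.pi := by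
  filter_upwards [self_mem_nhdsWithin,
    mem_nhdsWithin_of_mem_nhds (Iio_mem_nhds (by positivity : (0 : ℝ) < 2 * Real.pi))] with x h1 h2
  exact ⟨h1, h2⟩

section

variable {M : ℕ}

theorem sqSum_pos (hM : 3 ≤ M) : 0 < sqSum M := by
  have : (3 : ℝ) ≤ M := by exact_mod_cast hM
  rw [sqSum_eq]
  exact div_pos (mul_pos (by linarith) (by nlinarith)) (by norm_num)

/-- The coefficient of `x ^ 2` in `projPow M x`. -/
def projPowCoeff (M : ℕ) : ℝ := M * (M ^ 2 - 1) * (M ^ 2 - 4) / 720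

theorem projPowCoeff_pos (hM : 3 ≤ M) : 0 < projPowCoeff M := by
  have : (3 : ℝ) ≤ M := by exact_mod_cast hM
  exact div_pos (mul_pos (mul_pos (by linarith) (by nlinarith)) (by nlinarith)) (by norm_num)

/-- The minors are O(x³) and M - c is of order x², which gives order 4. The coefficient comes from
Σk⁶ Σk² - (Σk⁴)², which contains the factor M² - 9. -/
theorem leadingTerm_projPow_add_projCross (hM : 3 ≤ M) :
    LeadingTerm (fun x => projPow M x + projCross M x)
      (projPowCoeff M * ((M ^ 2 - 9) / 280)) 4 := by
  have h := (LeadingTerm.sum Finset.univ fun (k : Fin M) _ =>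
    LeadingTerm.sum Finset.univ fun (l : Fin M) _ =>
      (leadingTerm_evenMinor M k l).pow_two).const_mul 2
  have hp := sqSum_pos hM
  refine ((LeadingTerm.div (n := 4) h (leadingTerm_sub_cosSum M) (half_pos hp)).congr' ?_).coeff ?_
  · filter_upwards [eventually_mem_range] with x hx
    rw [projPow_add_projCross (sub_cosSum_pos hx.1 hx.2 hM) (add_cosSum_pos hx.1 hx.2 hM)]
  · have hs := sum_sum_minor_sq (fun m => arrayPos M m ^ 3) (arrayPos M)
    rw [show ∑ k, (fun m => arrayPos M m ^ 3) k ^ 2 = ∑ m, arrayPos M m ^ 6 from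
        Finset.sum_congr rfl fun m _ => by ring,
      show ∑ k, (fun m => arrayPos M m ^ 3) k * arrayPos M k = ∑ m, arrayPos M m ^ 4 from
        Finset.sum_congr rfl fun m _ => by ring, ← sqSum, sum_arrayPos_pow_four,
        sum_arrayPos_pow_six] at hs
    simp only [div_pow, neg_sq, ← Finset.sum_div]
    rw [hs]
    rw [div_eq_iff (half_pos hp).ne', sqSum_eq, projPowCoeff]
    ring

theorem leadingTerm_projPow_sub_projCross (hM : 3 ≤ M) :
    LeadingTerm (fun x => projPow M x - projCross M x) (2 * projPowCoeff M) 2 := by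
  have h := (LeadingTerm.sum Finset.univ fun (k : Fin M) _ =>
    LeadingTerm.sum Finset.univ fun (l : Fin M) _ =>
      (leadingTerm_oddMinor M k l).pow_two).const_mul 2
  have hM0 : (0 : ℝ) < 2 * M := by
    have : 0 < M := by omega
    positivity
  refine ((LeadingTerm.div (n := 2) h (leadingTerm_add_cosSum M) hM0).congr' ?_).coeff ?_
  · filter_upwards [eventually_mem_range] with x hx
    rw [projPow_sub_projCross (sub_cosSum_pos hx.1 hx.2 hM) (add_cosSum_pos hx.1 hx.2 hM)]
  · have hs := sum_sum_minor_sq (fun m => arrayPos M m ^ 2) (fun _ => 1)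
    rw [show ∑ k, (fun m => arrayPos M m ^ 2) k ^ 2 = ∑ m, arrayPos M m ^ 4 from
        Finset.sum_congr rfl fun m _ => by ring,
      show ∑ k, (fun m => arrayPos M m ^ 2) k * 1 = sqSum M from
        Finset.sum_congr rfl fun m _ => by ring, sum_arrayPos_pow_four] at hs
    simp only [one_pow, Finset.sum_const, Finset.card_univ, Fintype.card_fin, nsmul_eq_mul,
      mul_one] at hs
    simp only [div_pow, mul_one, ← Finset.sum_div]
    rw [hs, div_eq_iff hM0.ne', sqSum_eq, projPowCoeff]
    ring

theorem leadingTerm_projPow (hM : 3 ≤ M) :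
    LeadingTerm (fun x => projPow M x) (projPowCoeff M) 2 := by
  refine ((((leadingTerm_projPow_add_projCross hM).lower.add
    (leadingTerm_projPow_sub_projCross hM)).const_mul (1 / 2)).congr'
    (Filter.Eventually.of_forall fun x => ?_)).coeff (by ring)
  ring

/-- This is (α+β)(α-β)/α², of order 4 + 2 - 4; here the 140 of E arises, as 280/2. -/
theorem leadingTerm_one_sub_sq (hM : 3 ≤ M) :
    LeadingTerm (fun x => 1 - (projCross M x / projPow M x) ^ 2) ((M ^ 2 - 9) / 140) 2 := by
  have hpos := projPowCoeff_pos hM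
  have h := LeadingTerm.div (n := 2) ((leadingTerm_projPow_add_projCross hM).mul
    (leadingTerm_projPow_sub_projCross hM)) (leadingTerm_projPow hM).pow_two (by positivity)
  refine (h.congr' ?_).coeff ?_
  · filter_upwards [eventually_mem_range] with x hx
    have := projPow_pos hx.1 hx.2 hM
    field_simp
    ring
  · field_simp
    ring

/-- Since Mβ/α + c = M(α+β)/α - (M-c) is O(x²), its square over M² - c² is O(x²). Only the order
matters. -/
theorem leadingTerm_correction (hM : 3 ≤ M) : ∃ a,
    LeadingTerm (fun x => (M * (projCross M x / projPow M x) + cosSum M x) ^ 2 /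
      (M ^ 2 - cosSum M x ^ 2)) a 2 := by
  have hp := sqSum_pos hM
  have hM0 : (0 : ℝ) < M := by
    have : 0 < M := by omega
    positivity
  have h1 := (((LeadingTerm.div (n := 2) (leadingTerm_projPow_add_projCross hM)
    (leadingTerm_projPow hM) (projPowCoeff_pos hM)).const_mul M).sub
      (leadingTerm_sub_cosSum M)).pow_two
  have h2 := (leadingTerm_sub_cosSum M).mul (leadingTerm_add_cosSum M)
  refine ⟨_, (LeadingTerm.div (n := 2) h1 h2 (by positivity)).congr' ?_⟩
  filter_upwards [eventually_mem_range] with x hx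
  have := projPow_pos hx.1 hx.2 hM
  congr 1
  · congr 1
    field_simp
    ring
  · ring

/-- The projected powers of closely spaced sources, with relative errors of second order. -/
theorem exists_closely_spaced_bounds (hM : 3 ≤ M) : ∃ K u₀ : ℝ, 0 ≤ K ∧ 0 < u₀ ∧
    ∀ x, 0 < x → x < u₀ → x < 2 * Real.pi ∧ K * x ^ 2 ≤ 1 ∧ projPowCoeff M * x ^ 2 < sqSum M ∧
      |sqSum M * (projPowCoeff M * x ^ 2 - projPow M x) /
        (projPow M x * (sqSum M - projPowCoeff M * x ^ 2))| ≤ K * x ^ 2 ∧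
      |((M ^ 2 - 9) / 140 * x ^ 2 - (1 - (projCross M x / projPow M x) ^ 2)) /
        (1 - (projCross M x / projPow M x) ^ 2)| ≤ K * x ^ 2 ∧
      (M * (projCross M x / projPow M x) + cosSum M x) ^ 2 / (M ^ 2 - cosSum M x ^ 2) ≤
        K * x ^ 2 := by
  have hp := sqSum_pos hM
  have hα := projPowCoeff_pos hM
  have hden : LeadingTerm (fun x => sqSum M - projPowCoeff M * x ^ 2) (sqSum M) 0 :=
    ((LeadingTerm.const (sqSum M)).sub (LeadingTerm.monomial (projPowCoeff M) 2).lower).coeff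
      (by ring)
  have e1 : LeadingTerm (fun x => sqSum M * (projPowCoeff M * x ^ 2 - projPow M x) /
      (projPow M x * (sqSum M - projPowCoeff M * x ^ 2))) 0 0 :=
    (LeadingTerm.div (n := 0) ((((LeadingTerm.monomial (projPowCoeff M) 2).sub
      (leadingTerm_projPow hM)).const_mul (sqSum M))) ((leadingTerm_projPow hM).mul hden)
      (by positivity)).coeff (by ring)
  have e2 : LeadingTerm (fun x => ((M ^ 2 - 9) / 140 * x ^ 2 -
      (1 - (projCross M x / projPow M x) ^ 2)) / (1 - (projCross M x / projPow M x) ^ 2)) 0 0 := by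
    -- For M = 3 the leading coefficient is 0 and `LeadingTerm.div` does not apply, but both ε and
    -- its approximation vanish identically and the quotient is 0/0 = 0.
    rcases hM.eq_or_lt with rfl | h4
    · refine (LeadingTerm.const 0).congr' ?_
      filter_upwards [eventually_mem_range] with x hx
      have h0 : projPow 3 x + projCross 3 x = 0 := by
        rw [projPow_add_projCross (sub_cosSum_pos hx.1 hx.2 le_rfl)
          (add_cosSum_pos hx.1 hx.2 le_rfl)]
        simp [evenMinor_three]
      have h1 := projPow_pos hx.1 hx.2 le_rfl
      rw [show projCross 3 x = -projPow 3 x by linarith, neg_div, div_self h1.ne']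
      norm_num
    · have h4' : (4 : ℝ) ≤ M := by exact_mod_cast h4
      exact (LeadingTerm.div (n := 0) ((LeadingTerm.monomial ((M ^ 2 - 9 : ℝ) / 140) 2).sub
        (leadingTerm_one_sub_sq hM)) (leadingTerm_one_sub_sq hM)
        (div_pos (by nlinarith) (by norm_num))).coeff (by rw [sub_self, zero_div])
  obtain ⟨a, e3⟩ := leadingTerm_correction hM
  obtain ⟨K1, h1⟩ := e1.exists_bound
  obtain ⟨K2, h2⟩ := e2.exists_bound
  obtain ⟨K3, h3⟩ := e3.lower.exists_bound
  set K := max (max K1 K2) (max K3 0)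
  have hK1 : K1 ≤ K := (le_max_left _ _).trans (le_max_left _ _)
  have hK2 : K2 ≤ K := (le_max_right _ _).trans (le_max_left _ _)
  have hK3 : K3 ≤ K := (le_max_left _ _).trans (le_max_right _ _)
  have hK0 : 0 ≤ K := (le_max_right _ _).trans (le_max_right _ _)
  have h4 : ∀ᶠ x in nhdsWithin (0 : ℝ) (Set.Ioi 0), K * x ^ 2 ≤ 1 := by
    obtain h := ((by fun_prop : Continuous fun x : ℝ => K * x ^ 2).tendsto 0)
      (Iio_mem_nhds (by norm_num : K * 0 ^ 2 < 1))
    filter_upwards [mem_nhdsWithin_of_mem_nhds h] with x hx using le_of_lt hx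
  have h5 := hden.eventually_pos hp
  obtain ⟨u₀, hu₀, hu⟩ := mem_nhdsGT_iff_exists_Ioo_subset.1
    (h1.and (h2.and (h3.and (h4.and (h5.and eventually_mem_range)))))
  refine ⟨K, u₀, hK0, hu₀, fun x hx0 hx => ?_⟩
  obtain ⟨g1, g2, g3, g4, g5, g6⟩ := hu ⟨hx0, hx⟩
  have hx2 := sq_nonneg x
  refine ⟨g6.2, g4, ?_, g1.trans (by gcongr), g2.trans (by gcongr),
    (le_abs_self _).trans (g3.trans (by gcongr))⟩
  simp only [pow_zero, mul_one] at g5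
  linarith

end


/-! ### The gain as a function of the projected powers -/

/-- `1 - 2 |t| + t ^ 2` bounds `(1 - ρ ^ 2) sin² ψ` for `t = ρ cos ψ`. -/
theorem one_sub_sq_mul_sin_sq_le (ρ ψ : ℝ) :
    (1 - ρ ^ 2) * Real.sin ψ ^ 2 ≤ (1 - |ρ * Real.cos ψ|) ^ 2 := by
  rw [abs_mul, Real.sin_sq, ← sq_abs ρ, ← sq_abs (Real.cos ψ)]
  nlinarith [sq_nonneg (|ρ| - |Real.cos ψ|)]

theorem one_sub_sq_mul_sin_sq_le' {ρ : ℝ} (hρ : ρ ^ 2 ≤ 1) (ψ : ℝ) :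
    (1 - ρ ^ 2) * Real.sin ψ ^ 2 ≤ 1 - (ρ * Real.cos ψ) ^ 2 := by
  have h1 := mul_nonneg (sq_nonneg ρ) (sq_nonneg (Real.sin ψ))
  have h2 := mul_nonneg (sub_nonneg.2 hρ) (sq_nonneg (Real.cos ψ))
  rw [Real.sin_sq] at *
  nlinarith

section algebra

variable {M c α β p t h : ℝ}

theorem abs_mul_lt_of_sq (hα : 0 < α) (hL : 0 < α ^ 2 - t ^ 2 * β ^ 2) : |t * β| < α := by
  apply abs_lt_of_sq_lt_sq _ hα.le
  nlinarith

/-- With κ = (p-α)Mh and T = M² - t²c², the determinant of the non-circular matrix is α² - t²β² +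
(2κ(αM + t²βc) + κ²)/T. The right side splits the excess over 1 into a factor shaped like that of E
and a correction that turns out to be small. -/
theorem gain_formula (hM : 0 < M) (hα : 0 < α) (hp : α ≤ p) (hh : 0 ≤ h)
    (hL : 0 < α ^ 2 - t ^ 2 * β ^ 2) (hT : 0 < M ^ 2 - t ^ 2 * c ^ 2) :
    α / (α ^ 2 - (t * β) ^ 2) /
      ((α + (p - α) * M * h * (M / (M ^ 2 - t ^ 2 * c ^ 2))) /
        ((α + (p - α) * M * h * (M / (M ^ 2 - t ^ 2 * c ^ 2))) ^ 2 -
          (t * β - (p - α) * M * h * (t * c / (M ^ 2 - t ^ 2 * c ^ 2))) ^ 2)) =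
    1 + h * ((p - α) / α) / (1 - t ^ 2 + t ^ 2 * (1 - (β / α) ^ 2)) *
      (1 + α * t ^ 2 * (M * (β / α) + c) ^ 2 /
        (M * ((p - α) * M * h) + α * (M ^ 2 - t ^ 2 * c ^ 2))) := by
  set κ := (p - α) * M * h with hκ
  have hκ0 : 0 ≤ κ := mul_nonneg (mul_nonneg (by linarith) hM.le) hh
  obtain ⟨T, hTdef⟩ : ∃ T, T = M ^ 2 - t ^ 2 * c ^ 2 := ⟨_, rfl⟩
  rw [← hTdef] at hT ⊢
  have hX : 0 < α + κ * (M / T) := by positivity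
  have hZ : 0 < M * κ + α * T := by positivity
  have e1 : 1 - t ^ 2 + t ^ 2 * (1 - (β / α) ^ 2) = (α ^ 2 - t ^ 2 * β ^ 2) / α ^ 2 := by
    field_simp; ring
  have e2 : h * ((p - α) / α) = κ / (M * α) := by rw [hκ]; field_simp
  have e3 : α ^ 2 - (t * β) ^ 2 = α ^ 2 - t ^ 2 * β ^ 2 := by ring
  rw [e1, e2, e3, div_div_eq_mul_div]
  obtain ⟨L, hLdef⟩ : ∃ L, L = α ^ 2 - t ^ 2 * β ^ 2 := ⟨_, rfl⟩
  rw [← hLdef] at hL ⊢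
  have e4 : α + κ * (M / T) = (M * κ + α * T) / T := by field_simp; ring
  have e5 : (α + κ * (M / T)) ^ 2 - (t * β - κ * (t * c / T)) ^ 2 =
      L + (2 * κ * (α * M + t ^ 2 * β * c) + κ ^ 2) / T := by
    rw [hLdef]
    field_simp
    rw [hTdef]
    ring
  rw [e5, e4]
  field_simp
  rw [hLdef, hTdef]
  ring

theorem info_pos (hα : 0 < α) (hp : α ≤ p) (hh : 0 ≤ h) (hc : |c| < M) (ht : t ^ 2 ≤ 1)
    (hL : 0 < α ^ 2 - t ^ 2 * β ^ 2) :
    0 < α + (p - α) * M * h * (M / (M ^ 2 - t ^ 2 * c ^ 2)) ∧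
    0 < (α + (p - α) * M * h * (M / (M ^ 2 - t ^ 2 * c ^ 2))) ^ 2 -
      (t * β - (p - α) * M * h * (t * c / (M ^ 2 - t ^ 2 * c ^ 2))) ^ 2 := by
  have hM : 0 < M := (abs_nonneg c).trans_lt hc
  have htc : |t * c| < M := by
    rw [abs_mul]
    have := (sq_le_one_iff_abs_le_one t).1 ht
    nlinarith [abs_nonneg c]
  have hT : 0 < M ^ 2 - t ^ 2 * c ^ 2 := by
    nlinarith [sq_lt_sq' (abs_lt.1 htc).1 (abs_lt.1 htc).2]
  obtain ⟨h1, h2⟩ := abs_lt.1 (abs_mul_lt_of_sq hα hL)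
  obtain ⟨h3, h4⟩ := abs_lt.1 htc
  set κ := (p - α) * M * h
  have hκ0 : 0 ≤ κ := mul_nonneg (mul_nonneg (by linarith) hM.le) hh
  refine ⟨by positivity, ?_⟩
  -- The two factors are the eigenvalues of the information matrix.
  have e : (α + κ * (M / (M ^ 2 - t ^ 2 * c ^ 2))) ^ 2 -
      (t * β - κ * (t * c / (M ^ 2 - t ^ 2 * c ^ 2))) ^ 2 =
      ((α - t * β) + κ * ((M + t * c) / (M ^ 2 - t ^ 2 * c ^ 2))) *
        ((α + t * β) + κ * ((M - t * c) / (M ^ 2 - t ^ 2 * c ^ 2))) := by ring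
  rw [e]
  have h5 : 0 < M + t * c := by linarith
  have h6 : 0 < M - t * c := by linarith
  have h7 : 0 < α - t * β := by linarith
  have h8 : 0 < α + t * β := by linarith
  positivity

/-- The quotient is half the sum of the inverse eigenvalues 1/(x+y) and 1/(x-y), so it decreases in
each eigenvalue. -/
theorem div_sq_sub_sq_le {x y X Y : ℝ} (h1 : 0 < X + Y) (h2 : 0 < X - Y) (h3 : X + Y ≤ x + y)
    (h4 : X - Y ≤ x - y) : x / (x ^ 2 - y ^ 2) ≤ X / (X ^ 2 - Y ^ 2) := by
  have e : ∀ u v : ℝ, 0 < u + v → 0 < u - v →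
      u / (u ^ 2 - v ^ 2) = 1 / 2 * (1 / (u + v) + 1 / (u - v)) := by
    intro u v h h'
    rw [show u ^ 2 - v ^ 2 = (u + v) * (u - v) by ring]
    field_simp
    ring
  rw [e X Y h1 h2, e x y (h1.trans_le h3) (h2.trans_le h4)]
  gcongr

theorem div_sq_sub_sq_le_mul (hα : 0 < α) (hp : α ≤ p) (ht1 : |t| ≤ 1) (hβ : β ^ 2 ≤ α ^ 2)
    (hL : 0 < α ^ 2 - t ^ 2 * β ^ 2) {x : ℝ} (hxdef : x = α + (p - α) * (1 - |t|)) :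
    α / (α ^ 2 - (t * β) ^ 2) ≤ p / α * (x / (x ^ 2 - (t * β) ^ 2)) := by
  have hg : 0 ≤ p - α := by linarith
  have hp0 : 0 ≤ p := hα.le.trans hp
  have hx : α ≤ x := by
    have := mul_nonneg hg (sub_nonneg.2 ht1)
    linarith
  have hx0 : 0 < x := hα.trans_le hx
  have hL' : 0 < α ^ 2 - (t * β) ^ 2 := by rw [mul_pow]; exact hL
  have hxy : 0 < x ^ 2 - (t * β) ^ 2 := by
    have := pow_le_pow_left₀ hα.le hx 2
    linarith
  rw [div_mul_div_comm, div_le_div_iff₀ hL' (mul_pos hα hxy)]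
  have hts : t ^ 2 = |t| ^ 2 := (sq_abs t).symm
  have key2 : |t| * (2 * α + (p - α) - |t| * p) ≤ x := by
    have : x - |t| * (2 * α + (p - α) - |t| * p) = p * (1 - |t|) ^ 2 := by rw [hxdef]; ring
    have := mul_nonneg hp0 (sq_nonneg (1 - |t|))
    linarith
  -- After cross-multiplication and β² ≤ α² the claim becomes `key2`, whose slack is p(1-|t|)².
  have e3 : p * x * (α ^ 2 - (t * β) ^ 2) - α * (α * (x ^ 2 - (t * β) ^ 2)) =
      (p - α) * |t| * (α ^ 2 * x - |t| * β ^ 2 * (2 * α + (p - α) - |t| * p)) := by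
    rw [mul_pow, hts, hxdef]; ring
  have h9 : 0 ≤ 2 * α + (p - α) - |t| * p := by
    have := mul_le_of_le_one_left hp0 ht1
    linarith
  have h10 : |t| * β ^ 2 * (2 * α + (p - α) - |t| * p) ≤ α ^ 2 * x := by
    calc _ = β ^ 2 * (|t| * (2 * α + (p - α) - |t| * p)) := by ring
      _ ≤ α ^ 2 * (|t| * (2 * α + (p - α) - |t| * p)) :=
        mul_le_mul_of_nonneg_right hβ (mul_nonneg (abs_nonneg t) h9)
      _ ≤ _ := mul_le_mul_of_nonneg_left key2 (sq_nonneg α)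
  have h11 := mul_nonneg (mul_nonneg hg (abs_nonneg t)) (sub_nonneg.2 h10)
  linarith

/-- The non-circular eigenvalues are α ± tβ + κ/(M ± tc). As M ± tc ≥ M(1-|t|), the bound h ≤
(1-|t|)² gives κ/(M ± tc) ≤ (p-α)(1-|t|). Both eigenvalues are thus at most x ± tβ with x = α +
(p-α)(1-|t|), and `div_sq_sub_sq_le_mul` compares with that matrix. -/
theorem gain_le (hα : 0 < α) (hp : α ≤ p) (hh : 0 ≤ h) (hh' : h ≤ (1 - |t|) ^ 2)
    (hc : |c| < M) (ht : t ^ 2 ≤ 1) (hβ : β ^ 2 ≤ α ^ 2) (hL : 0 < α ^ 2 - t ^ 2 * β ^ 2) :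
    α / (α ^ 2 - (t * β) ^ 2) /
      ((α + (p - α) * M * h * (M / (M ^ 2 - t ^ 2 * c ^ 2))) /
        ((α + (p - α) * M * h * (M / (M ^ 2 - t ^ 2 * c ^ 2))) ^ 2 -
          (t * β - (p - α) * M * h * (t * c / (M ^ 2 - t ^ 2 * c ^ 2))) ^ 2)) ≤ p / α := by
  obtain ⟨hX, hν⟩ := info_pos hα hp hh hc ht hL
  have hM : 0 < M := (abs_nonneg c).trans_lt hc
  have ht1 : |t| ≤ 1 := (sq_le_one_iff_abs_le_one t).1 ht
  have hg : 0 ≤ p - α := by linarith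
  obtain ⟨h1, h2⟩ := abs_lt.1 (abs_mul_lt_of_sq hα hL)
  have hc' : 0 ≤ (p - α) * (1 - |t|) := mul_nonneg hg (by linarith)
  have htc : |t * c| ≤ |t| * M := by
    rw [abs_mul]; exact mul_le_mul_of_nonneg_left hc.le (abs_nonneg t)
  obtain ⟨h3, h4⟩ := abs_le.1 htc
  have htcM : |t * c| < M := by
    rw [abs_mul]; exact (mul_le_of_le_one_left (abs_nonneg c) ht1).trans_lt hc
  obtain ⟨h5, h6⟩ := abs_lt.1 htcM
  have hT : M ^ 2 - t ^ 2 * c ^ 2 = (M + t * c) * (M - t * c) := by ring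
  have h7 : 0 < M + t * c := by linarith
  have h8 : 0 < M - t * c := by linarith
  have hκ : (p - α) * M * h ≤ (p - α) * M * (1 - |t|) ^ 2 :=
    mul_le_mul_of_nonneg_left hh' (mul_nonneg hg hM.le)
  have hκ0 : 0 ≤ (p - α) * M * h := mul_nonneg (mul_nonneg hg hM.le) hh
  generalize (p - α) * M * h = κ at *
  have bound : ∀ z, M * (1 - |t|) ≤ z → 0 < z → κ / z ≤ (p - α) * (1 - |t|) := by
    intro z hz hz0
    rw [div_le_iff₀ hz0]
    calc _ ≤ _ := hκ
      _ = (p - α) * (1 - |t|) * (M * (1 - |t|)) := by ring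
      _ ≤ _ := mul_le_mul_of_nonneg_left hz hc'
  have b1 := bound (M + t * c) (by linarith) h7
  have b2 := bound (M - t * c) (by linarith) h8
  have e1 : (α + κ * (M / (M ^ 2 - t ^ 2 * c ^ 2))) +
      (t * β - κ * (t * c / (M ^ 2 - t ^ 2 * c ^ 2))) = α + t * β + κ / (M + t * c) := by
    rw [hT]; field_simp; ring
  have e2 : (α + κ * (M / (M ^ 2 - t ^ 2 * c ^ 2))) -
      (t * β - κ * (t * c / (M ^ 2 - t ^ 2 * c ^ 2))) = α - t * β + κ / (M - t * c) := by
    rw [hT]; field_simp; ring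
  have q1 : 0 ≤ κ / (M + t * c) := by positivity
  have q2 : 0 ≤ κ / (M - t * c) := by positivity
  have key := div_sq_sub_sq_le (x := α + (p - α) * (1 - |t|)) (y := t * β)
    (by rw [e1]; linarith) (by rw [e2]; linarith) (by rw [e1]; linarith) (by rw [e2]; linarith)
  rw [div_le_iff₀ (div_pos hX hν)]
  exact (div_sq_sub_sq_le_mul hα hp ht1 hβ hL rfl).trans
    (mul_le_mul_of_nonneg_left key (div_nonneg (hα.le.trans hp) hα.le))

/-- Dropping κ ≥ 0 and using t² ≤ 1 gives a bound free of the source parameters, which makes the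
approximation uniform. -/
theorem correction_le (hα : 0 < α) (hp : α ≤ p) (hh : 0 ≤ h) (hc : |c| < M) (ht : t ^ 2 ≤ 1)
    (b : ℝ) : α * t ^ 2 * (M * b + c) ^ 2 /
      (M * ((p - α) * M * h) + α * (M ^ 2 - t ^ 2 * c ^ 2)) ≤
        (M * b + c) ^ 2 / (M ^ 2 - c ^ 2) := by
  have hM : 0 < M := (abs_nonneg c).trans_lt hc
  have hD : 0 < M ^ 2 - c ^ 2 := by
    nlinarith [sq_lt_sq' (abs_lt.1 hc).1 (abs_lt.1 hc).2]
  have hT : M ^ 2 - c ^ 2 ≤ M ^ 2 - t ^ 2 * c ^ 2 := by nlinarith [sq_nonneg c]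
  have hκ0 : 0 ≤ M * ((p - α) * M * h) :=
    mul_nonneg hM.le (mul_nonneg (mul_nonneg (by linarith) hM.le) hh)
  calc _ ≤ α * (M * b + c) ^ 2 / (α * (M ^ 2 - c ^ 2)) := by
        apply div_le_div₀ (by positivity) _ (by positivity) (by nlinarith)
        have := mul_le_mul_of_nonneg_left ht (mul_nonneg hα.le (sq_nonneg (M * b + c)))
        nlinarith
    _ = _ := by field_simp

/-- The expansion has seven nonconstant monomials, each at most k because k ≤ 1. -/
theorem abs_mul_one_add_sub_one_le {k a b d : ℝ} (hk1 : k ≤ 1) (ha : |a| ≤ k) (hb : |b| ≤ k)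
    (hd : |d| ≤ k) : |(1 + a) * (1 + b) * (1 + d) - 1| ≤ 7 * k := by
  have hk : 0 ≤ k := (abs_nonneg a).trans ha
  have hab : |a * b| ≤ k := by
    rw [abs_mul]; nlinarith [abs_nonneg a, abs_nonneg b]
  have had : |a * d| ≤ k := by
    rw [abs_mul]; nlinarith [abs_nonneg a, abs_nonneg d]
  have hbd : |b * d| ≤ k := by
    rw [abs_mul]; nlinarith [abs_nonneg b, abs_nonneg d]
  have habd : |a * b * d| ≤ k := by
    rw [abs_mul]; nlinarith [abs_nonneg (a * b), abs_nonneg d]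
  rw [abs_le] at *
  constructor <;> nlinarith

end algebra


/-! ### The gain of two sources -/

theorem projPow_neg (M : ℕ) (x : ℝ) : projPow M (-x) = projPow M x := by
  simp [projPow, cosSum_neg, sinSum_neg]

theorem projCross_neg (M : ℕ) (x : ℝ) : projCross M (-x) = projCross M x := by
  simp [projCross, cosSum_neg, sinSum_neg, sqCosSum_neg]

theorem apply_abs_of_even {f : ℝ → ℝ} (hf : ∀ x, f (-x) = f x) (x : ℝ) : f |x| = f x := by
  rcases abs_choice x with h | h <;> rw [h]
  exact hf x

namespace TwoSources

variable {M : ℕ} (s : TwoSources M)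

theorem sep_pos : 0 < s.sep := abs_pos.2 (sub_ne_zero.2 s.freq_ne.symm)

theorem sep_lt : s.sep < 2 * Real.pi := s.freq_lt

theorem N_pos : 0 < s.N := by
  obtain ⟨t, -⟩ := Function.ne_iff.1 (s.symbols_ne 0)
  exact t.pos

/-- The norm of the symbols of a source. -/
def symbolNorm (i : Fin 2) : ℝ := Real.sqrt (∑ t, s.S₀ i t ^ 2)

theorem symbolNorm_pos (i : Fin 2) : 0 < s.symbolNorm i := by
  obtain ⟨t, ht⟩ := Function.ne_iff.1 (s.symbols_ne i)
  exact Real.sqrt_pos.2 (sum_sq_pos_of_ne t ht)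

theorem symbolNorm_sq (i : Fin 2) : s.symbolNorm i ^ 2 = ∑ t, s.S₀ i t ^ 2 :=
  Real.sq_sqrt (Finset.sum_nonneg fun _ _ => sq_nonneg _)

theorem corr_eq : s.corr = (∑ t, s.S₀ 0 t * s.S₀ 1 t) / (s.symbolNorm 0 * s.symbolNorm 1) := by
  have hN : (0 : ℝ) < s.N := by exact_mod_cast s.N_pos
  have h0 := s.symbolNorm_pos 0
  have h1 := s.symbolNorm_pos 1
  have h : Real.sqrt (empPower s.S₀ 0 * empPower s.S₀ 1) =
      s.symbolNorm 0 * s.symbolNorm 1 / s.N := by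
    rw [empPower, empPower, ← symbolNorm_sq, ← symbolNorm_sq,
      show s.symbolNorm 0 ^ 2 / s.N * (s.symbolNorm 1 ^ 2 / s.N) =
        (s.symbolNorm 0 * s.symbolNorm 1 / s.N) ^ 2 by ring]
    exact Real.sqrt_sq (by positivity)
  rw [corr, empCorr, h]
  field_simp

theorem dotProduct_symbols (i j : Fin 2) : s.S₀ i ⬝ᵥ s.S₀ j =
    s.symbolNorm i * s.symbolNorm j * !![1, s.corr; s.corr, 1] i j := by
  have h0 := (s.symbolNorm_pos 0).ne'
  have h1 := (s.symbolNorm_pos 1).ne'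
  have hd : ∀ i, s.S₀ i ⬝ᵥ s.S₀ i = s.symbolNorm i * s.symbolNorm i := fun i => by
    rw [← sq, symbolNorm_sq]
    exact Finset.sum_congr rfl fun _ _ => (sq _).symm
  have h01 : s.S₀ 0 ⬝ᵥ s.S₀ 1 = s.symbolNorm 0 * s.symbolNorm 1 * s.corr := by
    rw [corr_eq, mul_div_cancel₀ _ (mul_ne_zero h0 h1)]
    rfl
  fin_cases i <;> fin_cases j
  · simpa using hd 0
  · simpa using h01
  · rw [dotProduct_comm, mul_comm (s.symbolNorm _)]
    simpa using h01
  · simpa using hd 1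

theorem corr_sq_le : s.corr ^ 2 ≤ 1 := by
  have h0 := s.symbolNorm_pos 0
  have h1 := s.symbolNorm_pos 1
  rw [corr_eq, div_pow, div_le_one (by positivity), mul_pow, symbolNorm_sq, symbolNorm_sq]
  exact Finset.sum_mul_sq_le_sq_mul_sq _ _ _

/-- The correlation of the two sources after accounting for their phases. -/
def effCorr : ℝ := s.corr * Real.cos s.phaseSep

/-- The factor `(1 - ρ̂²) sin² Δφ`. -/
def ncFactor : ℝ := (1 - s.corr ^ 2) * Real.sin s.phaseSep ^ 2

/-- The relative deviation of the gain from its leading form. -/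
def correction : ℝ := projPow M s.sep * s.effCorr ^ 2 *
  (M * (projCross M s.sep / projPow M s.sep) + cosSum M s.sep) ^ 2 /
    (M * ((sqSum M - projPow M s.sep) * M * s.ncFactor) +
      projPow M s.sep * (M ^ 2 - s.effCorr ^ 2 * cosSum M s.sep ^ 2))

theorem ncFactor_nonneg : 0 ≤ s.ncFactor :=
  mul_nonneg (sub_nonneg.2 s.corr_sq_le) (sq_nonneg _)

theorem ncFactor_le : s.ncFactor ≤ 1 - s.effCorr ^ 2 :=
  one_sub_sq_mul_sin_sq_le' s.corr_sq_le _

theorem effCorr_sq_le : s.effCorr ^ 2 ≤ 1 := by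
  linarith [s.ncFactor_nonneg, s.ncFactor_le]

theorem effCorr_sq_lt_of_resolvable (h : s.Resolvable) (hM : ¬4 ≤ M) : s.effCorr ^ 2 < 1 := by
  rw [effCorr, mul_pow]
  exact h.resolve_left hM

section

variable (hM : 3 ≤ M)
include hM

theorem abs_cosSum_lt : |cosSum M s.sep| < M :=
  abs_lt.2 ⟨by linarith [add_cosSum_pos s.sep_pos s.sep_lt hM],
    by linarith [sub_cosSum_pos s.sep_pos s.sep_lt hM]⟩

theorem cosSum_sq_lt : cosSum M s.sep ^ 2 < (M : ℝ) ^ 2 := by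
  have h := abs_lt.1 (s.abs_cosSum_lt hM)
  exact sq_lt_sq' h.1 h.2

theorem projCross_sq_le : projCross M s.sep ^ 2 ≤ projPow M s.sep ^ 2 :=
  sq_le_sq' (by linarith [neg_projCross_le_projPow s.sep_pos s.sep_lt hM])
    (projCross_lt_projPow s.sep_pos s.sep_lt hM |>.le |> sub_nonneg.1)

theorem info_det_pos (h : s.Resolvable) :
    0 < projPow M s.sep ^ 2 - s.effCorr ^ 2 * projCross M s.sep ^ 2 := by
  have hα := projPow_pos s.sep_pos s.sep_lt hM
  have hβ := s.projCross_sq_le hM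
  have ht := s.effCorr_sq_le
  by_cases h4 : 4 ≤ M
  · have h1 := neg_projCross_lt_projPow s.sep_pos s.sep_lt h4
    have h2 := projCross_lt_projPow s.sep_pos s.sep_lt hM
    have h3 := mul_le_mul_of_nonneg_right ht (sq_nonneg (projCross M s.sep))
    nlinarith [mul_pos h1 h2]
  · have ht' := s.effCorr_sq_lt_of_resolvable h h4
    have h3 := mul_le_mul_of_nonneg_left hβ (sq_nonneg s.effCorr)
    nlinarith [sq_pos_of_pos hα]

theorem projPow_le_sqSum : projPow M s.sep ≤ sqSum M := by
  have h1 : 0 < (M : ℝ) ^ 2 - cosSum M s.sep ^ 2 := sub_pos.2 (s.cosSum_sq_lt hM)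
  rw [projPow]
  have : 0 ≤ sinSum M s.sep ^ 2 * M / ((M : ℝ) ^ 2 - cosSum M s.sep ^ 2) := by positivity
  linarith

/-- The two traces, as functions of the source separation, the effective correlation and
`ncFactor`. -/
theorem exists_traces_eq (h : s.Resolvable) : ∃ w : ℝ, 0 < w ∧
    s.trCrb = w * (projPow M s.sep / (projPow M s.sep ^ 2 -
      (s.effCorr * projCross M s.sep) ^ 2)) ∧
    s.trNcCrb = w * ((projPow M s.sep + (sqSum M - projPow M s.sep) * M * s.ncFactor *
        (M / (M ^ 2 - s.effCorr ^ 2 * cosSum M s.sep ^ 2))) /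
      ((projPow M s.sep + (sqSum M - projPow M s.sep) * M * s.ncFactor *
        (M / (M ^ 2 - s.effCorr ^ 2 * cosSum M s.sep ^ 2))) ^ 2 -
       (s.effCorr * projCross M s.sep - (sqSum M - projPow M s.sep) * M * s.ncFactor *
        (s.effCorr * cosSum M s.sep / (M ^ 2 - s.effCorr ^ 2 * cosSum M s.sep ^ 2))) ^ 2)) := by
  have hM0 : 0 < M := by omega
  have hα := projPow_pos s.sep_pos s.sep_lt hM
  have hL := s.info_det_pos hM h
  obtain ⟨hX, hν⟩ := info_pos hα (s.projPow_le_sqSum hM) s.ncFactor_nonneg (s.abs_cosSum_lt hM)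
    s.effCorr_sq_le hL
  -- All quantities are even in the frequency difference, so its sign may be dropped.
  have e1 : projPow M (s.μ 1 - s.μ 0) = projPow M s.sep :=
    (apply_abs_of_even (projPow_neg M) _).symm
  have e2 : projCross M (s.μ 1 - s.μ 0) = projCross M s.sep :=
    (apply_abs_of_even (projCross_neg M) _).symm
  have e3 : cosSum M (s.μ 1 - s.μ 0) = cosSum M s.sep :=
    (apply_abs_of_even (cosSum_neg M) _).symm
  have e4 : sinSum M (s.μ 1 - s.μ 0) ^ 2 = sinSum M s.sep ^ 2 :=
    (apply_abs_of_even (f := fun x => sinSum M x ^ 2)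
      (fun x => by simp only [sinSum_neg, neg_sq]) _).symm
  have e5 : (s.φ 1 + s.δ * s.μ 1) - (s.φ 0 + s.δ * s.μ 0) = s.phaseSep := by
    rw [phaseSep]; ring
  -- By definition of α, s²M/(M²-c²) = p - α.
  have e6 : ncTerm M (s.μ 1 - s.μ 0) s.corr s.phaseSep =
      (sqSum M - projPow M s.sep) * M * s.ncFactor := by
    rw [ncTerm, e3, e4, projPow, ncFactor]; ring
  have e7 : (M : ℝ) ^ 2 - s.corr ^ 2 * cosSum M s.sep ^ 2 * Real.cos s.phaseSep ^ 2 =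
      (M : ℝ) ^ 2 - s.effCorr ^ 2 * cosSum M s.sep ^ 2 := by rw [effCorr]; ring
  have e8 : ncDiag M (s.μ 1 - s.μ 0) s.corr s.phaseSep =
      projPow M s.sep + (sqSum M - projPow M s.sep) * M * s.ncFactor *
        (M / (M ^ 2 - s.effCorr ^ 2 * cosSum M s.sep ^ 2)) := by
    rw [ncDiag, e1, e3, e6, e7]
  have e9 : ncOffDiag M (s.μ 1 - s.μ 0) s.corr s.phaseSep =
      s.effCorr * projCross M s.sep - (sqSum M - projPow M s.sep) * M * s.ncFactor *
        (s.effCorr * cosSum M s.sep / (M ^ 2 - s.effCorr ^ 2 * cosSum M s.sep ^ 2)) := by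
    rw [ncOffDiag, e2, e3, e6, e7, effCorr]; ring
  have hn0 := s.symbolNorm_pos 0
  have hn1 := s.symbolNorm_pos 1
  have hn : ∀ i, s.symbolNorm i ≠ 0 := fun i => (s.symbolNorm_pos i).ne'
  have hσ := s.noise_pos
  have hc : cosSum M (s.μ 1 - s.μ 0) ^ 2 < (M : ℝ) ^ 2 := by rw [e3]; exact s.cosSum_sq_lt hM
  have e10 : s.corr * projCross M s.sep * Real.cos s.phaseSep =
    s.effCorr * projCross M s.sep := by rw [effCorr]; ring
  have t1 := trace_crb (φ := s.φ) (ρ := s.corr) s.δ hM0 s.N_pos hσ hc hn s.dotProduct_symbols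
    (by rw [e1, e2, e5, e10, mul_pow]; exact hL.ne')
  have t2 := trace_ncCrb (φ := s.φ) (ρ := s.corr) s.δ hM0 s.N_pos hσ s.corr_sq_le s.symbols_ne hc
    hn s.dotProduct_symbols (by rw [e5, e8, e9]; exact hν.ne')
  rw [e1, e2, e5, e10] at t1
  rw [e5, e8, e9] at t2
  exact ⟨1 / (2 / s.σ2) * (1 / s.symbolNorm 0 ^ 2 + 1 / s.symbolNorm 1 ^ 2), by positivity, t1, t2⟩

theorem traces_pos (h : s.Resolvable) : 0 < s.trCrb ∧ 0 < s.trNcCrb := by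
  have hα := projPow_pos s.sep_pos s.sep_lt hM
  have hL := s.info_det_pos hM h
  obtain ⟨hX, hν⟩ := info_pos hα (s.projPow_le_sqSum hM) s.ncFactor_nonneg (s.abs_cosSum_lt hM)
    s.effCorr_sq_le hL
  obtain ⟨w, hw, h1, h2⟩ := s.exists_traces_eq hM h
  rw [h1, h2]
  rw [← mul_pow] at hL
  exact ⟨mul_pos hw (div_pos hα hL), mul_pos hw (div_pos hX hν)⟩

theorem gain_eq (h : s.Resolvable) : s.gain =
    1 + s.ncFactor * ((sqSum M - projPow M s.sep) / projPow M s.sep) /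
      (1 - s.effCorr ^ 2 + s.effCorr ^ 2 * (1 - (projCross M s.sep / projPow M s.sep) ^ 2)) *
      (1 + s.correction) := by
  obtain ⟨w, hw, h1, h2⟩ := s.exists_traces_eq hM h
  have hM0 : 0 < M := by omega
  have hT : 0 < (M : ℝ) ^ 2 - s.effCorr ^ 2 * cosSum M s.sep ^ 2 := by
    have := s.cosSum_sq_lt hM
    have := mul_le_mul_of_nonneg_right s.effCorr_sq_le (sq_nonneg (cosSum M s.sep))
    linarith
  rw [gain, h1, h2, mul_div_mul_left _ _ hw.ne']
  exact gain_formula (by exact_mod_cast hM0) (projPow_pos s.sep_pos s.sep_lt hM)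
    (s.projPow_le_sqSum hM) s.ncFactor_nonneg (s.info_det_pos hM h) hT

theorem gain_le_max (h : s.Resolvable) : s.gain ≤ sqSum M / projPow M s.sep := by
  obtain ⟨w, hw, h1, h2⟩ := s.exists_traces_eq hM h
  rw [gain, h1, h2, mul_div_mul_left _ _ hw.ne']
  exact gain_le (projPow_pos s.sep_pos s.sep_lt hM) (s.projPow_le_sqSum hM) s.ncFactor_nonneg
    (one_sub_sq_mul_sin_sq_le _ _) (s.abs_cosSum_lt hM) s.effCorr_sq_le (s.projCross_sq_le hM)
    (s.info_det_pos hM h)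

theorem gain_eq_max (h0 : s.corr = 0) (hcos : Real.cos s.phaseSep = 0) :
    s.gain = sqSum M / projPow M s.sep := by
  have ht : s.effCorr = 0 := by rw [effCorr, h0, zero_mul]
  have hsin : s.ncFactor = 1 := by rw [ncFactor, h0, Real.sin_sq, hcos]; norm_num
  have hα := projPow_pos s.sep_pos s.sep_lt hM
  rw [s.gain_eq hM (Or.inr (by rw [h0]; norm_num)), correction, ht, hsin]
  field_simp
  ring

/-- The denominator in the leading form of the gain expression. -/
theorem exprDen_pos (h : s.Resolvable) :
    0 < 1 - s.effCorr ^ 2 + s.effCorr ^ 2 * (((M : ℝ) ^ 2 - 9) / 140 * s.sep ^ 2) := by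
  have ht := s.effCorr_sq_le
  have hM' : (3 : ℝ) ≤ M := by exact_mod_cast hM
  have hu := sq_pos_of_pos s.sep_pos
  by_cases h4 : 4 ≤ M
  · have h4' : (4 : ℝ) ≤ M := by exact_mod_cast h4
    have hε : 0 < ((M : ℝ) ^ 2 - 9) / 140 * s.sep ^ 2 :=
      mul_pos (div_pos (by nlinarith) (by norm_num)) hu
    rcases ht.lt_or_eq with ht' | ht'
    · have := mul_nonneg (sq_nonneg s.effCorr) hε.le
      linarith
    · rw [ht']; linarith
  · have ht' := s.effCorr_sq_lt_of_resolvable h h4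
    have : 0 ≤ s.effCorr ^ 2 * (((M : ℝ) ^ 2 - 9) / 140 * s.sep ^ 2) :=
      mul_nonneg (sq_nonneg _) (mul_nonneg (div_nonneg (by nlinarith) (by norm_num)) hu.le)
    linarith

/-- E is the gain formula with leading terms inserted; the 60 is 720/12, from p/`projPowCoeff M` =
60/(M²-4). -/
theorem gainExpr_eq (h : s.Resolvable) : gainExpr M s.sep s.corr s.phaseSep =
    1 + s.ncFactor * ((sqSum M - projPowCoeff M * s.sep ^ 2) / (projPowCoeff M * s.sep ^ 2)) /
      (1 - s.effCorr ^ 2 + s.effCorr ^ 2 * (((M : ℝ) ^ 2 - 9) / 140 * s.sep ^ 2)) := by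
  have hD := (s.exprDen_pos hM h).ne'
  have hM' : (3 : ℝ) ≤ M := by exact_mod_cast hM
  have hu := s.sep_pos
  have m0 : (M : ℝ) ≠ 0 := by linarith
  have m1 : (M : ℝ) - 1 ≠ 0 := by linarith
  have m2 : (M : ℝ) - 2 ≠ 0 := by linarith
  have m3 : (M : ℝ) + 1 ≠ 0 := by linarith
  have m4 : (M : ℝ) + 2 ≠ 0 := by linarith
  have e1 : s.sep ^ 2 * s.corr ^ 2 * (M - 3) * (M + 3) * Real.cos s.phaseSep ^ 2 +
      140 * (1 - s.corr ^ 2 * Real.cos s.phaseSep ^ 2) = 140 * (1 - s.effCorr ^ 2 +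
        s.effCorr ^ 2 * (((M : ℝ) ^ 2 - 9) / 140 * s.sep ^ 2)) := by rw [effCorr]; ring
  have e2 : projPowCoeff M = M * ((M - 1) * (M + 1)) * ((M - 2) * (M + 2)) / 720 := by
    rw [projPowCoeff]; ring
  have e3 : sqSum M = M * ((M - 1) * (M + 1)) / 12 := by rw [sqSum_eq]; ring
  rw [gainExpr, e1, e2, e3, ncFactor]
  generalize 1 - s.effCorr ^ 2 + s.effCorr ^ 2 * (((M : ℝ) ^ 2 - 9) / 140 * s.sep ^ 2) = D at hD ⊢
  field_simp
  ring

theorem maxGainExpr_eq : maxGainExpr M s.sep = sqSum M / (projPowCoeff M * s.sep ^ 2) := by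
  have hM' : (3 : ℝ) ≤ M := by exact_mod_cast hM
  have hu := s.sep_pos
  have m0 : (M : ℝ) ≠ 0 := by linarith
  have m1 : (M : ℝ) - 1 ≠ 0 := by linarith
  have m2 : (M : ℝ) - 2 ≠ 0 := by linarith
  have m3 : (M : ℝ) + 1 ≠ 0 := by linarith
  have m4 : (M : ℝ) + 2 ≠ 0 := by linarith
  have e2 : projPowCoeff M = M * ((M - 1) * (M + 1)) * ((M - 2) * (M + 2)) / 720 := by
    rw [projPowCoeff]; ring
  have e3 : sqSum M = M * ((M - 1) * (M + 1)) / 12 := by rw [sqSum_eq]; ring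
  rw [maxGainExpr, e2, e3]
  field_simp
  norm_num

theorem gainExpr_eq_max (h0 : s.corr = 0) (hcos : Real.cos s.phaseSep = 0) :
    gainExpr M s.sep s.corr s.phaseSep = maxGainExpr M s.sep := by
  have ht : s.effCorr = 0 := by rw [effCorr, h0, zero_mul]
  have hsin : s.ncFactor = 1 := by rw [ncFactor, h0, Real.sin_sq, hcos]; norm_num
  have hα : 0 < projPowCoeff M * s.sep ^ 2 :=
    mul_pos (projPowCoeff_pos hM) (sq_pos_of_pos s.sep_pos)
  rw [s.gainExpr_eq hM (Or.inr (by rw [h0]; norm_num)), s.maxGainExpr_eq hM, ht, hsin, sub_div,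
    div_self hα.ne']
  simp

theorem gainExpr_le_max (h : s.Resolvable) (hu : s.sep ^ 2 * ((M - 2) * (M + 2)) ≤ 60) :
    gainExpr M s.sep s.corr s.phaseSep ≤ maxGainExpr M s.sep := by
  have hM' : (3 : ℝ) ≤ M := by exact_mod_cast hM
  have hα : 0 < projPowCoeff M * s.sep ^ 2 :=
    mul_pos (projPowCoeff_pos hM) (sq_pos_of_pos s.sep_pos)
  have hp := sqSum_pos hM
  have hle : projPowCoeff M * s.sep ^ 2 ≤ sqSum M := by
    have e : projPowCoeff M * s.sep ^ 2 =
        sqSum M * (s.sep ^ 2 * ((M - 2) * (M + 2)) / 60) := by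
      rw [projPowCoeff, sqSum_eq]; ring
    rw [e]
    exact mul_le_of_le_one_right hp.le (by linarith)
  have hε : 0 ≤ ((M : ℝ) ^ 2 - 9) / 140 * s.sep ^ 2 :=
    mul_nonneg (div_nonneg (by nlinarith) (by norm_num)) (sq_nonneg _)
  have hD := s.exprDen_pos hM h
  rw [s.gainExpr_eq hM h, s.maxGainExpr_eq hM]
  have hg : 0 ≤ (sqSum M - projPowCoeff M * s.sep ^ 2) / (projPowCoeff M * s.sep ^ 2) :=
    div_nonneg (by linarith) hα.le
  have e : sqSum M / (projPowCoeff M * s.sep ^ 2) =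
      1 + (sqSum M - projPowCoeff M * s.sep ^ 2) / (projPowCoeff M * s.sep ^ 2) := by
    rw [sub_div, div_self hα.ne']; ring
  rw [e]
  -- The numerator factor h is at most the denominator; the assumption on the separation makes the
  -- remaining factor nonnegative.
  have : s.ncFactor ≤ 1 - s.effCorr ^ 2 +
      s.effCorr ^ 2 * (((M : ℝ) ^ 2 - 9) / 140 * s.sep ^ 2) := by
    linarith [s.ncFactor_le, mul_nonneg (sq_nonneg s.effCorr) hε]
  refine add_le_add le_rfl ?_
  rw [div_le_iff₀ hD, mul_comm]
  exact mul_le_mul_of_nonneg_left this hg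

theorem no_gain (h : s.Resolvable) (h0 : |s.corr| = 1 ∨ Real.sin s.phaseSep = 0) :
    s.gain = 1 ∧ gainExpr M s.sep s.corr s.phaseSep = 1 := by
  have hf : s.ncFactor = 0 := by
    rcases h0 with h0 | h0
    · rw [ncFactor, ← sq_abs, h0]; norm_num
    · rw [ncFactor, h0]; norm_num
  constructor
  · rw [s.gain_eq hM h, hf]; simp
  · rw [s.gainExpr_eq hM h, hf]; simp

theorem gain_approx {k : ℝ} (h : s.Resolvable) (hk1 : k ≤ 1)
    (hlt : projPowCoeff M * s.sep ^ 2 < sqSum M)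
    (h1 : |sqSum M * (projPowCoeff M * s.sep ^ 2 - projPow M s.sep) /
        (projPow M s.sep * (sqSum M - projPowCoeff M * s.sep ^ 2))| ≤ k)
    (h2 : |((M ^ 2 - 9) / 140 * s.sep ^ 2 - (1 - (projCross M s.sep / projPow M s.sep) ^ 2)) /
        (1 - (projCross M s.sep / projPow M s.sep) ^ 2)| ≤ k)
    (h3 : (M * (projCross M s.sep / projPow M s.sep) + cosSum M s.sep) ^ 2 /
      (M ^ 2 - cosSum M s.sep ^ 2) ≤ k) :
    0 < gainExpr M s.sep s.corr s.phaseSep ∧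
      |s.gain - gainExpr M s.sep s.corr s.phaseSep| ≤
        7 * k * gainExpr M s.sep s.corr s.phaseSep := by
  have hk : 0 ≤ k := (abs_nonneg _).trans h1
  have hα := projPow_pos s.sep_pos s.sep_lt hM
  have hα0 : 0 < projPowCoeff M * s.sep ^ 2 :=
    mul_pos (projPowCoeff_pos hM) (sq_pos_of_pos s.sep_pos)
  have hD0 := s.exprDen_pos hM h
  have ht := s.effCorr_sq_le
  have hε : 0 ≤ 1 - (projCross M s.sep / projPow M s.sep) ^ 2 := by
    rw [div_pow, sub_nonneg, div_le_one (by positivity)]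
    exact s.projCross_sq_le hM
  have hD : 0 < 1 - s.effCorr ^ 2 +
      s.effCorr ^ 2 * (1 - (projCross M s.sep / projPow M s.sep) ^ 2) := by
    have e : 1 - s.effCorr ^ 2 + s.effCorr ^ 2 *
        (1 - (projCross M s.sep / projPow M s.sep) ^ 2) = (projPow M s.sep ^ 2 -
          s.effCorr ^ 2 * projCross M s.sep ^ 2) / projPow M s.sep ^ 2 := by
      field_simp; ring
    rw [e]
    exact div_pos (s.info_det_pos hM h) (by positivity)
  have hr : |s.correction| ≤ k := by
    have hc := s.cosSum_sq_lt hM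
    have hnn : 0 ≤ s.correction := by
      have h5 : 0 ≤ (M : ℝ) ^ 2 - s.effCorr ^ 2 * cosSum M s.sep ^ 2 := by
        have := mul_le_mul_of_nonneg_right ht (sq_nonneg (cosSum M s.sep))
        linarith
      have h6 := sub_nonneg.2 (s.projPow_le_sqSum hM)
      have h7 := s.ncFactor_nonneg
      exact div_nonneg (by positivity) (by positivity)
    rw [abs_of_nonneg hnn]
    exact (correction_le hα (s.projPow_le_sqSum hM) s.ncFactor_nonneg (s.abs_cosSum_lt hM) ht
      _).trans h3
  -- Adding 1 - t² ≥ 0 to t²ε in the denominator cannot increase the relative error, so it is at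
  -- most that of ε. If ε = 0, then M = 3 and the error vanishes.
  have hη : |s.effCorr ^ 2 * ((M ^ 2 - 9) / 140 * s.sep ^ 2 -
      (1 - (projCross M s.sep / projPow M s.sep) ^ 2)) / (1 - s.effCorr ^ 2 +
        s.effCorr ^ 2 * (1 - (projCross M s.sep / projPow M s.sep) ^ 2))| ≤ k := by
    rcases hε.eq_or_lt with hε0 | hε0
    · have h3 : M = 3 := by
        by_contra hne
        have h4 := mul_pos (neg_projCross_lt_projPow s.sep_pos s.sep_lt
          (by omega : 4 ≤ M)) (projCross_lt_projPow s.sep_pos s.sep_lt hM)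
        have : 1 - (projCross M s.sep / projPow M s.sep) ^ 2 =
          ((projPow M s.sep + projCross M s.sep) * (projPow M s.sep - projCross M s.sep)) /
            projPow M s.sep ^ 2 := by field_simp; ring
        rw [this] at hε0
        exact (div_pos h4 (by positivity)).ne hε0
      have h9 : ((M : ℝ) ^ 2 - 9) = 0 := by rw [h3]; norm_num
      rw [← hε0, h9]
      simpa using hk
    · refine le_trans ?_ h2
      rw [abs_div, abs_div, abs_of_pos hD, abs_of_pos hε0, abs_mul, abs_of_nonneg (sq_nonneg _),
        div_le_div_iff₀ hD hε0]
      have : s.effCorr ^ 2 * (1 - (projCross M s.sep / projPow M s.sep) ^ 2) ≤ 1 - s.effCorr ^ 2 +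
        s.effCorr ^ 2 * (1 - (projCross M s.sep / projPow M s.sep) ^ 2) := by linarith
      have := mul_le_mul_of_nonneg_left this (abs_nonneg ((M ^ 2 - 9) / 140 * s.sep ^ 2 -
        (1 - (projCross M s.sep / projPow M s.sep) ^ 2)))
      linarith
  have key := abs_mul_one_add_sub_one_le hk1 h1 hη hr
  rw [s.gain_eq hM h, s.gainExpr_eq hM h]
  have hf := s.ncFactor_nonneg
  set f := s.ncFactor
  set r := s.correction
  set p := sqSum M
  set α := projPow M s.sep
  set ε := 1 - (projCross M s.sep / α) ^ 2
  set ε' := ((M : ℝ) ^ 2 - 9) / 140 * s.sep ^ 2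
  set α' := projPowCoeff M * s.sep ^ 2
  set t := s.effCorr
  have hpα : 0 < p - α' := by linarith
  have hE : 0 ≤ f * ((p - α') / α') / (1 - t ^ 2 + t ^ 2 * ε') := by positivity
  refine ⟨by linarith, ?_⟩
  have e1 : (p - α) / α = (p - α') / α' * (1 + p * (α' - α) / (α * (p - α'))) := by
    field_simp
    ring
  have e2 : 1 / (1 - t ^ 2 + t ^ 2 * ε) = 1 / (1 - t ^ 2 + t ^ 2 * ε') *
      (1 + t ^ 2 * (ε' - ε) / (1 - t ^ 2 + t ^ 2 * ε)) := by
    rw [div_mul_eq_mul_div, one_mul, eq_div_iff hD0.ne', div_mul_eq_mul_div, one_mul,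
      div_eq_iff hD.ne', add_mul, div_mul_cancel₀ _ hD.ne']
    ring
  have e3 : 1 + f * ((p - α) / α) / (1 - t ^ 2 + t ^ 2 * ε) * (1 + r) -
      (1 + f * ((p - α') / α') / (1 - t ^ 2 + t ^ 2 * ε')) =
      f * ((p - α') / α') / (1 - t ^ 2 + t ^ 2 * ε') *
        ((1 + p * (α' - α) / (α * (p - α'))) *
          (1 + t ^ 2 * (ε' - ε) / (1 - t ^ 2 + t ^ 2 * ε)) * (1 + r) - 1) := by
    rw [div_eq_mul_one_div (f * ((p - α) / α)), e1, e2]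
    ring
  -- The error is relative to E - 1, hence also relative to the larger E.
  rw [e3, abs_mul, abs_of_nonneg hE]
  have := mul_le_mul_of_nonneg_left key hE
  nlinarith

end

end TwoSources

end NCGain
end

/-! ### Assembly of the theorem -/

theorem mainTheorem9 (M : ℕ) (hM : 3 ≤ M) :
    -- the two bounds are finite and positive (in particular the Fisher matrices are invertible)
    (∀ c : NCGain.TwoSources M, c.Resolvable → 0 < c.trCrb ∧ 0 < c.trNcCrb) ∧
    -- the approximation, with relative error of order Δμ², uniformly in all other quantities
    (∃ K : ℝ, ∃ u₀ : ℝ, 0 < u₀ ∧ ∀ c : NCGain.TwoSources M, c.Resolvable → c.sep < u₀ →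
      0 < NCGain.gainExpr M c.sep c.corr c.phaseSep ∧
      |c.gain - NCGain.gainExpr M c.sep c.corr c.phaseSep| ≤
        K * c.sep ^ 2 * NCGain.gainExpr M c.sep c.corr c.phaseSep ∧
      (c.corr = 0 → Real.cos c.phaseSep = 0 →
        |c.gain - NCGain.maxGainExpr M c.sep| ≤
          K * c.sep ^ 2 * NCGain.maxGainExpr M c.sep)) ∧
    -- no gain for coherent sources or equal phases: both the gain and the expression equal 1
    (∀ c : NCGain.TwoSources M, c.Resolvable →
      (|c.corr| = 1 ∨ Real.sin c.phaseSep = 0) →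
        c.gain = 1 ∧ NCGain.gainExpr M c.sep c.corr c.phaseSep = 1) ∧
    -- maximality of the expression
    (∀ c : NCGain.TwoSources M, c.Resolvable →
      (c.corr = 0 → Real.cos c.phaseSep = 0 →
        NCGain.gainExpr M c.sep c.corr c.phaseSep = NCGain.maxGainExpr M c.sep) ∧
      (c.sep ^ 2 * ((M - 2) * (M + 2)) ≤ 60 →
        NCGain.gainExpr M c.sep c.corr c.phaseSep ≤ NCGain.maxGainExpr M c.sep)) ∧
    -- maximality of the gain itself
    (∀ c c' : NCGain.TwoSources M, c.Resolvable → c.sep = c'.sep →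
      c'.corr = 0 → Real.cos c'.phaseSep = 0 → c.gain ≤ c'.gain) := by
  refine ⟨fun c hc => c.traces_pos hM hc, ?_, fun c hc h => c.no_gain hM hc h,
    fun c hc => ⟨fun h0 hcos => c.gainExpr_eq_max hM h0 hcos,
      fun hu => c.gainExpr_le_max hM hc hu⟩, ?_⟩
  · obtain ⟨K, u₀, hK, hu₀, hbound⟩ := NCGain.exists_closely_spaced_bounds hM
    refine ⟨7 * K, u₀, hu₀, fun c hc hsep => ?_⟩
    obtain ⟨-, hk1, hlt, h1, h2, h3⟩ := hbound c.sep c.sep_pos hsep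
    obtain ⟨hpos, happ⟩ := c.gain_approx hM hc hk1 hlt h1 h2 h3
    rw [← mul_assoc] at happ
    refine ⟨hpos, happ, fun h0 hcos => ?_⟩
    rwa [c.gainExpr_eq_max hM h0 hcos] at happ
  · intro c c' hc hsep h0 hcos
    rw [c'.gain_eq_max hM h0 hcos, ← hsep]
    exact c.gain_le_max hM hc
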